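/- Compact groups are Hausdorff, and their morphisms are the continuous homomorphisms. A family $(\iota_i\colon H\to G_i)_{i\in I}$ of embeddings of compact groups is \emph{algebraically sound} if the canonical map $\coprod_{H,\mathrm{Gp}}G_i\to\coprod_{H,\mathrm{CGp}}G_i$, from the multi-pushout of the $\iota_i$ in the category of groups (the free product of the $G_i$ amalgamated over $H$) to the multi-pushout of the $\iota_i$ in the category of compact groups, is one-to-one. The embedding $\iota_i$ is \emph{normal} if $\iota_i(H)$ is a normal subgroup of $G_i$. For a compact group $H$, let $\mathrm{Aut}(H)$ be the group of topological automorphisms of $H$ with the topology of uniform convergence (equivalently, the compact-open topology). \textbf{Corollary.} For a compact group $H$, the following conditions are equivalent: (a) every finite family of normal embeddings $\iota_i\colon H\trianglelefteq G_i$ of compact groups is algebraically sound; (b) the poset of compact subgroups of $\mathrm{Aut}(H)$, ordered by inclusion, is filtered (directed), i.e. every finite set of compact subgroups of $\mathrm{Aut}(H)$ is contained in a common compact subgroup of $\mathrm{Aut}(H)$. -/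

import Mathlib

universe u

/-! ### The topological automorphism group of a topological group -/

section Automorphisms

variable (H : Type u) [Group H] [TopologicalSpace H]

/-- The group of topological automorphisms of `H`, under composition. -/
instance contAutGroup : Group (H ≃ₜ* H) where
  mul a b := b.trans a
  one := ContinuousMulEquiv.refl H
  inv a := a.symm
  mul_assoc _ _ _ := rfl
  one_mul _ := rfl
  mul_one _ := rfl
  inv_mul_cancel a := ContinuousMulEquiv.ext fun x => a.symm_apply_apply x

/-- A topological automorphism as a continuous self-map. -/
def contAutToContinuousMap (a : H ≃ₜ* H) : C(H, H) := ⟨a, a.continuous⟩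

/-- The automorphism group carries the compact-open topology of `C(H, H)`. For compact `H` this
is the topology of uniform convergence. -/
instance contAutTopology : TopologicalSpace (H ≃ₜ* H) :=
  TopologicalSpace.induced (contAutToContinuousMap H) ContinuousMap.compactOpen

/-- The poset of compact subgroups of the topological automorphism group of `H`,
ordered by inclusion. -/
abbrev CompactAutSubgroup : Type u :=
  {K : Subgroup (H ≃ₜ* H) // IsCompact (K : Set (H ≃ₜ* H))}

end Automorphisms

/-- A poset is filtered if every finite set of elements has an upper bound. -/
def IsFilteredPoset (P : Type u) [PartialOrder P] : Prop :=
  ∀ s : Set P, s.Finite → ∃ b : P, ∀ a ∈ s, a ≤ b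

/-! ### Families of embeddings of compact groups and their multi-pushouts

A compact group is a compact Hausdorff topological group, and the morphisms between compact groups
are the continuous homomorphisms. -/

section Pushout

variable {ι : Type} {H : Type u} [Group H] [TopologicalSpace H]
  {G : ι → Type u} [∀ i, Group (G i)] [∀ i, TopologicalSpace (G i)]

/-- A morphism is a normal embedding if it is a group and topological embedding
with normal image. -/
structure IsNormalEmbedding {H : Type u} {G : Type u} [Group H] [TopologicalSpace H]
    [Group G] [TopologicalSpace G] (φ : H →ₜ* G) : Prop where
  isEmbedding : Topology.IsEmbedding φ
  normal : φ.toMonoidHom.range.Normal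

/-- The multi-pushout, in the category of groups, of a family of continuous homomorphisms
`φ i : H → G i`, i.e. the free product of the `G i` amalgamated over `H`. -/
abbrev AlgPushout (φ : ∀ i, H →ₜ* G i) : Type u :=
  Monoid.PushoutI fun i => (φ i).toMonoidHom

/-- `P`, with structure maps `j i : G i → P` and `b : H → P`, is a multi-pushout (the colimit of
the diagram consisting of the maps `φ i : H → G i`) in the category of compact groups. -/
structure IsCompactPushout (φ : ∀ i, H →ₜ* G i) {P : Type u} [Group P] [TopologicalSpace P]
    (j : ∀ i, G i →ₜ* P) (b : H →ₜ* P) : Prop where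
  isTopologicalGroup : IsTopologicalGroup P
  compactSpace : CompactSpace P
  t2Space : T2Space P
  comm : ∀ i, (j i).comp (φ i) = b
  existsUnique_desc : ∀ (K : Type u) [Group K] [TopologicalSpace K] [IsTopologicalGroup K]
    [CompactSpace K] [T2Space K] (k : ∀ i, G i →ₜ* K) (h : H →ₜ* K),
    (∀ i, (k i).comp (φ i) = h) →
      ∃! f : P →ₜ* K, (∀ i, f.comp (j i) = k i) ∧ f.comp b = h

/-- The canonical map out of the group-theoretic multi-pushout determined by a
compatible family of continuous homomorphisms. -/
def algPushoutMap (φ : ∀ i, H →ₜ* G i) {P : Type*} [Group P] [TopologicalSpace P]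
    (j : ∀ i, G i →ₜ* P) (b : H →ₜ* P) (comm : ∀ i, (j i).comp (φ i) = b) :
    AlgPushout φ →* P :=
  Monoid.PushoutI.lift (fun i => (j i).toMonoidHom) b.toMonoidHom fun i =>
    MonoidHom.ext fun x => DFunLike.congr_fun (comm i) x

theorem algPushoutMap_of (φ : ∀ i, H →ₜ* G i) {P : Type*} [Group P] [TopologicalSpace P]
    (j : ∀ i, G i →ₜ* P) (b : H →ₜ* P) (comm : ∀ i, (j i).comp (φ i) = b) (i : ι) (x : G i) :
    algPushoutMap φ j b comm (Monoid.PushoutI.of i x) = j i x :=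
  Monoid.PushoutI.lift_of _ _ _ x

theorem algPushoutMap_base (φ : ∀ i, H →ₜ* G i) {P : Type*} [Group P] [TopologicalSpace P]
    (j : ∀ i, G i →ₜ* P) (b : H →ₜ* P) (comm : ∀ i, (j i).comp (φ i) = b) (x : H) :
    algPushoutMap φ j b comm (Monoid.PushoutI.base _ x) = b x :=
  Monoid.PushoutI.lift_base _ _ _ x

/-- A family of morphisms of compact groups is algebraically sound if the canonical map from the
multi-pushout in groups to the multi-pushout in compact groups is one-to-one. The latter
exists (`exists_isCompactPushout`) and is unique up to a unique isomorphism. -/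
def AlgebraicallySound (φ : ∀ i, H →ₜ* G i) : Prop :=
  ∃ (P : Type u) (_ : Group P) (_ : TopologicalSpace P) (j : ∀ i, G i →ₜ* P) (b : H →ₜ* P)
    (hP : IsCompactPushout φ j b), Function.Injective (algPushoutMap φ j b hP.comm)

/-- A compact group together with a compatible family of morphisms into it. -/
structure CompactCocone (φ : ∀ i, H →ₜ* G i) : Type (u + 1) where
  K : Type u
  [group : Group K]
  [top : TopologicalSpace K]
  [topGroup : IsTopologicalGroup K]
  [compact : CompactSpace K]
  [t2 : T2Space K]
  k : ∀ i, G i →ₜ* K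
  h : H →ₜ* K
  comm : ∀ i, (k i).comp (φ i) = h

attribute [instance] CompactCocone.group CompactCocone.top CompactCocone.topGroup
  CompactCocone.compact CompactCocone.t2

/-- A Hausdorff regular space with a dense subset parametrized by a `u`-small type is `u`-small. -/
theorem small_of_denseRange {X : Type u} {Y : Type*} [TopologicalSpace Y] [T3Space Y]
    (f : X → Y) (hf : DenseRange f) : Small.{u} Y := by
  refine small_of_injective (β := Set (Set X)) (f := fun y => {A | y ∈ closure (f '' A)}) ?_
  intro y z hyz
  by_contra hne
  obtain ⟨U, hU, hUc, hz⟩ : ∃ U ∈ nhds y, IsClosed U ∧ z ∉ U := by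
    obtain ⟨U, hU, hUc, hs⟩ := exists_mem_nhds_isClosed_subset
      (isOpen_compl_singleton.mem_nhds (show y ∈ ({z}ᶜ : Set Y) from hne))
    exact ⟨U, hU, hUc, fun h => hs h rfl⟩
  have hy : (f ⁻¹' U) ∈ {A | y ∈ closure (f '' A)} := by
    rw [Set.mem_ofPred_eq, mem_closure_iff_nhds]
    intro V hV
    obtain ⟨x, hx⟩ := hf.exists_mem_open isOpen_interior
      ⟨y, mem_interior_iff_mem_nhds.2 (Filter.inter_mem hV hU)⟩
    have := interior_subset hx
    exact ⟨f x, this.1, x, this.2, rfl⟩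
  have hz' : z ∈ closure (f '' (f ⁻¹' U)) := by
    have : (f ⁻¹' U) ∈ {A | z ∈ closure (f '' A)} := by
      have h := hyz
      simp only at h
      rwa [h] at hy
    exact this
  exact hz (closure_minimal (Set.image_preimage_subset f U) hUc hz')

/-- Multi-pushouts exist in the category of compact groups. -/
theorem exists_isCompactPushout (φ : ∀ i, H →ₜ* G i) :
    ∃ (P : Type u) (_ : Group P) (_ : TopologicalSpace P) (j : ∀ i, G i →ₜ* P) (b : H →ₜ* P),
      IsCompactPushout φ j b := by
  let Q := ∀ c : CompactCocone φ, c.K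
  let m : AlgPushout φ →* Q :=
    MonoidHom.pi fun c => algPushoutMap φ c.k c.h c.comm
  let S : Subgroup Q := m.range.topologicalClosure
  have hS : IsClosed (S : Set Q) := m.range.isClosed_topologicalClosure
  have : CompactSpace S := isCompact_iff_compactSpace.1 hS.isCompact
  let g : AlgPushout φ →* S :=
    m.codRestrict S fun x => m.range.le_topologicalClosure ⟨x, rfl⟩
  have hg : DenseRange g := by
    intro y
    rw [closure_subtype]
    have hy : (y : Q) ∈ closure (Set.range m) := y.2
    rwa [← Set.range_comp]
  have : Small.{u} S := small_of_denseRange g hg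
  let e : Shrink.{u} S ≃* S := Shrink.mulEquiv
  let _ : TopologicalSpace (Shrink.{u} S) := TopologicalSpace.induced e inferInstance
  let E : Shrink.{u} S ≃ₜ S := e.toEquiv.toHomeomorphOfIsInducing ⟨rfl⟩
  have hE : ∀ x, E x = e x := fun _ => rfl
  have : IsTopologicalGroup (Shrink.{u} S) := topologicalGroup_induced e
  have : CompactSpace (Shrink.{u} S) := E.symm.compactSpace
  have : T2Space (Shrink.{u} S) := E.symm.t2Space
  have hcj : ∀ i, Continuous fun x : G i => e.symm (g (Monoid.PushoutI.of i x)) := by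
    intro i
    refine E.symm.continuous.comp (Continuous.subtype_mk (continuous_pi fun c => ?_) _)
    exact (c.k i).continuous_toFun.congr fun x => (algPushoutMap_of φ c.k c.h c.comm i x).symm
  have hcb : Continuous fun x : H => e.symm (g (Monoid.PushoutI.base _ x)) := by
    refine E.symm.continuous.comp (Continuous.subtype_mk (continuous_pi fun c => ?_) _)
    exact c.h.continuous_toFun.congr fun x => (algPushoutMap_base φ c.k c.h c.comm x).symm
  let w : AlgPushout φ →* Shrink.{u} S := e.symm.toMonoidHom.comp g
  let j : ∀ i, G i →ₜ* Shrink.{u} S := fun i =>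
    { w.comp (Monoid.PushoutI.of i) with continuous_toFun := hcj i }
  let b : H →ₜ* Shrink.{u} S :=
    { w.comp (Monoid.PushoutI.base _) with continuous_toFun := hcb }
  have hw : DenseRange w := E.symm.surjective.denseRange.comp hg E.symm.continuous
  refine ⟨Shrink.{u} S, inferInstance, inferInstance, j, b,
    inferInstance, inferInstance, inferInstance, ?_, ?_⟩
  · intro i
    refine DFunLike.ext _ _ fun x => ?_
    exact congrArg w (Monoid.PushoutI.of_apply_eq_base _ i x)
  · intro K _ _ _ _ _ k h hk
    let c : CompactCocone φ := ⟨K, k, h, hk⟩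
    let f : Shrink.{u} S →ₜ* K :=
      { (Pi.evalMonoidHom (fun c : CompactCocone φ => c.K) c).comp
          (S.subtype.comp e.toMonoidHom) with
        continuous_toFun :=
          (continuous_apply c).comp (continuous_subtype_val.comp E.continuous) }
    have hf : ∀ y, f (w y) = algPushoutMap φ k h hk y := by
      intro y
      change ((e (e.symm (g y)) : S) : Q) c = _
      rw [e.apply_symm_apply]
      rfl
    refine ⟨f, ⟨fun i => ?_, ?_⟩, ?_⟩
    · ext x
      exact (hf _).trans (algPushoutMap_of φ k h hk i x)
    · ext x
      exact (hf _).trans (algPushoutMap_base φ k h hk x)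
    · rintro f' ⟨h1, h2⟩
      have hm : f'.toMonoidHom.comp w = f.toMonoidHom.comp w := by
        refine Monoid.PushoutI.hom_ext (fun i => ?_) ?_
        · ext x
          exact (DFunLike.congr_fun (h1 i) x).trans
            ((hf _).trans (algPushoutMap_of φ k h hk i x)).symm
        · ext x
          exact (DFunLike.congr_fun h2 x).trans
            ((hf _).trans (algPushoutMap_base φ k h hk x)).symm
      have := hw.equalizer f'.continuous_toFun f.continuous_toFun
        (funext fun y => DFunLike.congr_fun hm y)
      exact DFunLike.coe_injective this

end Pushout

/-! Suppose first that the poset is filtered. For a finite family of normal embeddings, each G_i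
acts on H by conjugation through a compact subgroup of Aut(H), so all these actions lie in one
compact subgroup K. The unitary groups are compact, so it suffices to detect every nontrivial
element w of the amalgamated product by unitary representations of the G_i that agree on H
(`algebraicallySound_of_separating`). There are two cases.

If w lies outside H, it is h times a nonempty reduced word, and representations trivial on H
suffice. They are built letter by letter: for each new letter a representation of the corresponding
G_i/H is glued on along one basis vector, so that the word carries a basis vector to a vector with a
coordinate that the starting vector lacks (`exists_wordVec_ne_zero`).

If w is an element h of H, the compact group H ⋊ K has by Peter–Weyl a representation that is
nontrivial at h. Its restriction σ to H is K-invariant, since K acts on H by inner automorphisms of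
H ⋊ K (`exists_invariant_unitaryRep_ne_one`). Clifford theory shows that for each i some positive
multiple of σ is the restriction of a representation of G_i (`exists_mult_comp_eq`). As there are
finitely many i, the multiples can be made equal, and after unitary changes of basis the extensions
agree on H.

Conversely, apply soundness to the embeddings of H into H ⋊ K_i for finitely many compact subgroups
K_i. Then H embeds in the compact pushout P, and its normalizer in P is compact and contains the
image of every K_i. The conjugation action of this normalizer on H is a compact subgroup of Aut(H)
containing all K_i. -/

/-! ### Peter–Weyl: finite-dimensional unitary representations separate points -/

open MeasureTheory in
/-- Every nonzero vector of a strongly continuous unitary representation of a compact group has a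
nonzero inner product with a vector of a finite-dimensional invariant subspace. -/
theorem exists_finiteDimensional_invariant_inner_ne_zero
    {G : Type*} [Group G] [TopologicalSpace G] [IsTopologicalGroup G] [CompactSpace G]
    {E : Type*} [NormedAddCommGroup E] [InnerProductSpace ℂ E] [CompleteSpace E]
    (U : G →* (E ≃ₗᵢ[ℂ] E)) (hU : ∀ v, Continuous fun g => U g v) {v : E} (hv : v ≠ 0) :
    ∃ F : Submodule ℂ E, FiniteDimensional ℂ F ∧ (∀ g, ∀ x ∈ F, U g x ∈ F) ∧
      ∃ x ∈ F, inner ℂ v x ≠ 0 := by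
  borelize G
  let μ : Measure G := Measure.haarMeasure ⊤
  have : IsProbabilityMeasure μ := ⟨Measure.haarMeasure_self⟩
  have hc : Continuous fun g => InnerProductSpace.rankOne ℂ (U g v) (U g v) :=
    ((ContinuousLinearMap.smulRightL ℂ E E).continuous.comp
      ((innerSL ℂ).continuous.comp (hU v))).clm_apply (hU v)
  have hint : Integrable (fun g => InnerProductSpace.rankOne ℂ (U g v) (U g v)) μ :=
    hc.integrable_of_hasCompactSupport (HasCompactSupport.of_compactSpace _)
  -- The average of the projections onto the translates of v (up to scale) is compact, symmetric and
  -- commutes with the action, so its eigenspaces for nonzero eigenvalues are finite-dimensional and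
  -- invariant.
  let T : E →L[ℂ] E := ∫ g, InnerProductSpace.rankOne ℂ (U g v) (U g v) ∂μ
  have hTx : ∀ x, T x = ∫ g, inner ℂ (U g v) x • U g v ∂μ := fun x => by
    rw [ContinuousLinearMap.integral_apply hint]; rfl
  have hint' : ∀ x, Integrable (fun g => inner ℂ (U g v) x • U g v) μ := fun x =>
    Continuous.integrable_of_hasCompactSupport
      (((hU v).inner continuous_const).smul (hU v)) (HasCompactSupport.of_compactSpace _)
  have hTi : ∀ x y, inner ℂ y (T x) = ∫ g, inner ℂ (U g v) x * inner ℂ y (U g v) ∂μ := by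
    intro x y
    rw [hTx, ← integral_inner (hint' x)]
    simp only [inner_smul_right]
  have hcomp : IsCompactOperator T := by
    have := Convex.integral_mem (μ := μ) (s := {A : E →L[ℂ] E | IsCompactOperator A})
      (f := fun g => InnerProductSpace.rankOne ℂ (U g v) (U g v))
      ((compactOperator (RingHom.id ℂ) E E).restrictScalars ℝ).convex
      isClosed_setOfPred_isCompactOperator (Filter.Eventually.of_forall fun g => ?_) hint
    · exact this
    · exact (isCompactOperator_of_locallyCompactSpace_rng
        (ContinuousLinearMap.toSpanSingleton ℂ (U g v))).comp_clm (innerSL ℂ (U g v))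
  have hsymm : T.IsSymmetric := by
    intro x y
    change inner ℂ (T x) y = inner ℂ x (T y)
    rw [← inner_conj_symm, hTi, hTi, ← integral_conj]
    refine integral_congr_ae (Filter.Eventually.of_forall fun g => ?_)
    simp only [map_mul, inner_conj_symm]
    ring
  have hcommute : ∀ h x, T (U h x) = U h (T x) := by
    intro h x
    rw [hTx, hTx]
    have h1 : U h (∫ g, inner ℂ (U g v) x • U g v ∂μ)
        = ∫ g, inner ℂ (U (h * g) v) (U h x) • U (h * g) v ∂μ := by
      have h2 := ((U h).toContinuousLinearEquiv : E →L[ℂ] E).integral_comp_comm (hint' x)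
      refine h2.symm.trans (integral_congr_ae (Filter.Eventually.of_forall fun g => ?_))
      simp [map_smul]
    rw [h1]
    exact (integral_mul_left_eq_self (fun g => inner ℂ (U g v) (U h x) • U g v) h).symm
  by_contra! hcon
  have horth : ∀ c : ℂ, c ≠ 0 → ∀ x, T x = c • x → inner ℂ v x = 0 := by
    intro c hc x hx
    refine hcon (Module.End.eigenspace (T : Module.End ℂ E) c)
      (T.finite_dimensional_eigenspace hcomp c hc) (fun g y hy => ?_) x ?_
    · rw [Module.End.mem_eigenspace_iff] at hy ⊢
      change T _ = _
      change T y = c • y at hy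
      rw [hcommute, hy, map_smul]
    · rw [Module.End.mem_eigenspace_iff]
      exact hx
  -- For a nonzero eigenvalue this is the assumed orthogonality of v; on the kernel it is the
  -- symmetry of T. The spectral theorem then gives T v = 0, and ⟨v, T v⟩ is the integral of |⟨v, U
  -- g v⟩|².
  have hTv : T v ∈ (⨆ c, Module.End.eigenspace (T : Module.End ℂ E) c)ᗮ := by
    rw [← Submodule.iInf_orthogonal, Submodule.mem_iInf]
    intro c x hx
    rw [Module.End.mem_eigenspace_iff] at hx
    change T x = c • x at hx
    rw [← show inner ℂ (T x) v = inner ℂ x (T v) from hsymm x v, hx, inner_smul_left]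
    by_cases hc : c = 0
    · simp [hc]
    · rw [← inner_conj_symm, horth c hc x hx]; simp
  rw [T.orthogonalComplement_iSup_eigenspaces_eq_bot hcomp hsymm, Submodule.mem_bot] at hTv
  have h0 : ∫ g, ‖inner ℂ v (U g v)‖ ^ 2 ∂μ = 0 := by
    have h1 := hTi v v
    rw [hTv, inner_zero_right] at h1
    have h2 : ∀ g, inner ℂ (U g v) v * inner ℂ v (U g v)
        = ((‖inner ℂ v (U g v)‖ ^ 2 : ℝ) : ℂ) := by
      intro g
      rw [← inner_conj_symm, RCLike.conj_mul]
      norm_cast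
    simp only [h2] at h1
    rw [integral_complex_ofReal] at h1
    exact_mod_cast h1.symm
  have hcn : Continuous fun g => ‖inner ℂ v (U g v)‖ ^ 2 :=
    (continuous_const.inner (hU v)).norm.pow 2
  rw [integral_eq_zero_iff_of_nonneg (fun g => by positivity)
    (hcn.integrable_of_hasCompactSupport (HasCompactSupport.of_compactSpace _))] at h0
  have h1 : (fun g => ‖inner ℂ v (U g v)‖ ^ 2) = fun _ => (0 : ℝ) :=
    (Continuous.ae_eq_iff_eq μ hcn continuous_const).1 h0
  have h2 := congrFun h1 1
  simp only [map_one, LinearIsometryEquiv.coe_one, id_eq] at h2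
  exact hv (by simpa using h2)

open Matrix in
/-- A continuous finite-dimensional unitary matrix representation. -/
structure UnitaryRep (G : Type*) [Group G] [TopologicalSpace G] where
  n : Type
  [fintype : Fintype n]
  [decEq : DecidableEq n]
  toHom : G →* Matrix n n ℂ
  continuous_toHom : Continuous toHom
  conjTranspose_mul_self : ∀ g, (toHom g)ᴴ * toHom g = 1

attribute [instance] UnitaryRep.fintype UnitaryRep.decEq

open Matrix in
/-- The matrices of a strongly continuous unitary representation on a finite-dimensional invariant
subspace form a unitary representation. -/
theorem exists_unitaryRep_of_invariant {G : Type*} [Group G] [TopologicalSpace G]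
    {E : Type*} [NormedAddCommGroup E] [InnerProductSpace ℂ E]
    (U : G →* (E ≃ₗᵢ[ℂ] E)) (hU : ∀ v, Continuous fun g => U g v)
    (F : Submodule ℂ E) [FiniteDimensional ℂ F] (hF : ∀ g, ∀ x ∈ F, U g x ∈ F) :
    ∃ ρ : UnitaryRep G, ∀ g, ρ.toHom g = 1 → ∀ x ∈ F, U g x = x := by
  let b := stdOrthonormalBasis ℂ F
  let L : G → (F →ₗ[ℂ] F) := fun g => (U g).toLinearEquiv.toLinearMap.restrict (hF g)
  have hL : ∀ g (x : F), (L g x : E) = U g x := fun _ _ => rfl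
  let M : G →* Matrix (Fin (Module.finrank ℂ F)) (Fin (Module.finrank ℂ F)) ℂ :=
    { toFun := fun g => LinearMap.toMatrix b.toBasis b.toBasis (L g)
      map_one' := by
        rw [← LinearMap.toMatrix_one b.toBasis]
        congr 1
        ext x
        simp [hL]
      map_mul' := fun g h => by
        rw [← LinearMap.toMatrix_mul]
        congr 1
        ext x
        simp [hL] }
  have hM : ∀ g i j, M g i j = inner ℂ (b i : E) (U g (b j)) := by
    intro g i j
    change LinearMap.toMatrix b.toBasis b.toBasis (L g) i j = _
    rw [LinearMap.toMatrix_apply, OrthonormalBasis.coe_toBasis_repr_apply,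
      OrthonormalBasis.repr_apply_apply, OrthonormalBasis.coe_toBasis]
    rfl
  have hinv : ∀ g, (M g)ᴴ = M g⁻¹ := by
    intro g
    ext i j
    have h1 : U g (U g⁻¹ (b j)) = b j := by
      rw [map_inv]
      exact (U g).apply_symm_apply _
    rw [conjTranspose_apply, hM, hM, ← LinearIsometryEquiv.inner_map_map (U g) (b i : E), h1]
    exact inner_conj_symm _ _
  refine ⟨⟨_, M, ?_, fun g => by rw [hinv, ← map_mul, inv_mul_cancel, map_one]⟩, ?_⟩
  · refine continuous_matrix fun i j => ?_
    simp only [hM]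
    exact continuous_const.inner (hU _)
  · intro g hg x hx
    have h1 : L g = 1 := by
      apply (LinearMap.toMatrix b.toBasis b.toBasis).injective
      rw [LinearMap.toMatrix_one]
      exact hg
    have := congrArg Subtype.val (LinearMap.congr_fun h1 ⟨x, hx⟩)
    exact this

open MeasureTheory in
/-- A compact group acts on the square integrable functions by left translations. -/
theorem exists_faithful_unitary_action (G : Type u) [Group G] [TopologicalSpace G]
    [IsTopologicalGroup G] [CompactSpace G] [T2Space G] :
    ∃ (E : Type u) (_ : NormedAddCommGroup E) (_ : InnerProductSpace ℂ E) (_ : CompleteSpace E)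
      (U : G →* (E ≃ₗᵢ[ℂ] E)), (∀ v, Continuous fun g => U g v) ∧
      ∀ g, g ≠ 1 → ∃ v, U g v ≠ v := by
  borelize G
  let μ : Measure G := Measure.haarMeasure ⊤
  have : IsProbabilityMeasure μ := ⟨Measure.haarMeasure_self⟩
  let V : G → (Lp ℂ 2 μ →ₗᵢ[ℂ] Lp ℂ 2 μ) := fun g =>
    { toFun := fun f => DomMulAct.mk g⁻¹ • f
      map_add' := fun f f' => smul_add _ f f'
      map_smul' := fun c f => smul_comm _ c f
      norm_map' := fun f => DomMulAct.norm_smul_Lp _ f }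
  have hV : ∀ g f, V g f = DomMulAct.mk g⁻¹ • f := fun _ _ => rfl
  have hV1 : ∀ f, V 1 f = f := fun f => by rw [hV, inv_one]; exact one_smul _ f
  have hVmul : ∀ g h f, V (g * h) f = V g (V h f) := fun g h f => by
    rw [hV, hV, hV, smul_smul, mul_inv_rev]; rfl
  let U : G →* (Lp ℂ 2 μ ≃ₗᵢ[ℂ] Lp ℂ 2 μ) :=
    { toFun := fun g =>
        { (V g) with
          invFun := V g⁻¹
          left_inv := fun f => (hVmul g⁻¹ g f).symm.trans (by rw [inv_mul_cancel, hV1])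
          right_inv := fun f => (hVmul g g⁻¹ f).symm.trans (by rw [mul_inv_cancel, hV1])
          norm_map' := (V g).norm_map }
      map_one' := LinearIsometryEquiv.ext hV1
      map_mul' := fun g h => LinearIsometryEquiv.ext (hVmul g h) }
  refine ⟨Lp ℂ 2 μ, inferInstance, inferInstance, inferInstance, U, fun v => ?_, fun g hg => ?_⟩
  · have : Fact ((2 : ENNReal) ≠ ⊤) := ⟨by simp⟩
    change Continuous fun g => DomMulAct.mk g⁻¹ • v
    have h2 : Continuous fun g : G => DomMulAct.mk g⁻¹ :=
      DomMulAct.continuous_mk.comp continuous_inv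
    exact h2.smul continuous_const
  · by_contra! hcon
    -- A Urysohn function distinguishing g⁻¹ from 1 is moved by g: Haar measure charges every
    -- nonempty open set, so continuous functions that agree almost everywhere are equal.
    obtain ⟨f, hf0, hf1, -⟩ := exists_continuous_zero_one_of_isClosed
      (isClosed_singleton (x := g⁻¹)) (isClosed_singleton (x := (1 : G)))
      (Set.disjoint_singleton.2 (by simpa using hg))
    let F : C(G, ℂ) := ⟨fun x => (f x : ℂ), by fun_prop⟩
    have hF : MemLp F 2 μ := F.continuous.memLp_of_hasCompactSupport
      (HasCompactSupport.of_compactSpace _)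
    have h1 : DomMulAct.mk g⁻¹ • hF.toLp F = hF.toLp F := hcon _
    rw [DomMulAct.mk_smul_toLp, MemLp.toLp_eq_toLp_iff] at h1
    have h2 := (Continuous.ae_eq_iff_eq μ (F.continuous.comp (continuous_const_smul g⁻¹))
      F.continuous).1 h1
    have h3 := congrFun h2 1
    have h4 : f g⁻¹ = f 1 := by simpa [F] using h3
    rw [hf0 rfl, hf1 rfl] at h4
    simp at h4

/-- The finite-dimensional unitary representations of a compact group separate its points. -/
theorem exists_unitaryRep_ne_one {G : Type u} [Group G] [TopologicalSpace G]
    [IsTopologicalGroup G] [CompactSpace G] [T2Space G] {g : G} (hg : g ≠ 1) :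
    ∃ ρ : UnitaryRep G, ρ.toHom g ≠ 1 := by
  obtain ⟨E, _, _, _, U, hU, hfaith⟩ := exists_faithful_unitary_action G
  obtain ⟨v, hv⟩ := hfaith g hg
  obtain ⟨F, _, hF, x, hx, hne⟩ :=
    exists_finiteDimensional_invariant_inner_ne_zero U hU (sub_ne_zero.2 hv)
  obtain ⟨ρ, hρ⟩ := exists_unitaryRep_of_invariant U hU F hF
  refine ⟨ρ, fun h => hne ?_⟩
  -- If g fixes F pointwise, then ⟨U g v, x⟩ = ⟨U g v, U g x⟩ = ⟨v, x⟩, so U g v - v is orthogonal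
  -- to x.
  rw [inner_sub_left, ← hρ g h x hx, LinearIsometryEquiv.inner_map_map, hρ g h x hx, sub_self]

/-! ### Intertwiners, multiplicities and direct sums -/

section UnitaryRepTheory

open Matrix

namespace UnitaryRep

variable {G : Type*} [Group G] [TopologicalSpace G]

theorem self_mul_conjTranspose (ρ : UnitaryRep G) (g : G) : ρ.toHom g * (ρ.toHom g)ᴴ = 1 :=
  mul_eq_one_comm.1 (ρ.conjTranspose_mul_self g)

theorem conjTranspose_toHom (ρ : UnitaryRep G) (g : G) : (ρ.toHom g)ᴴ = ρ.toHom g⁻¹ := by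
  rw [← mul_one (ρ.toHom g)ᴴ, ← map_one ρ.toHom, ← mul_inv_cancel g, map_mul, ← mul_assoc,
    ρ.conjTranspose_mul_self, one_mul]

/-- The space of intertwining matrices. -/
def intertwiners (ρ σ : UnitaryRep G) : Submodule ℂ (Matrix σ.n ρ.n ℂ) where
  carrier := {X | ∀ g, σ.toHom g * X = X * ρ.toHom g}
  add_mem' hX hY g := by rw [Matrix.mul_add, Matrix.add_mul, hX g, hY g]
  zero_mem' g := by simp
  smul_mem' c X hX g := by rw [Matrix.mul_smul, Matrix.smul_mul, hX g]

theorem mem_intertwiners {ρ σ : UnitaryRep G} {X : Matrix σ.n ρ.n ℂ} :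
    X ∈ intertwiners ρ σ ↔ ∀ g, σ.toHom g * X = X * ρ.toHom g := Iff.rfl

theorem one_mem_intertwiners (ρ : UnitaryRep G) : (1 : Matrix ρ.n ρ.n ℂ) ∈ intertwiners ρ ρ :=
  fun g => by rw [mul_one, one_mul]

theorem mul_mem_intertwiners {ρ σ τ : UnitaryRep G} {Y : Matrix τ.n σ.n ℂ} {X : Matrix σ.n ρ.n ℂ}
    (hY : Y ∈ intertwiners σ τ) (hX : X ∈ intertwiners ρ σ) : Y * X ∈ intertwiners ρ τ :=
  fun g => by rw [← Matrix.mul_assoc, hY g, Matrix.mul_assoc, hX g, Matrix.mul_assoc]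

theorem conjTranspose_mem_intertwiners {ρ σ : UnitaryRep G} {X : Matrix σ.n ρ.n ℂ}
    (hX : X ∈ intertwiners ρ σ) : Xᴴ ∈ intertwiners σ ρ := fun g => by
  have := congrArg conjTranspose (hX g⁻¹)
  rw [conjTranspose_mul, conjTranspose_mul, conjTranspose_toHom, conjTranspose_toHom,
    inv_inv] at this
  exact this.symm

/-- The dimension of the space of intertwiners. For irreducible `ρ` it is the multiplicity of `ρ`
in `σ`. -/
noncomputable def mult (ρ σ : UnitaryRep G) : ℕ := Module.finrank ℂ (intertwiners ρ σ)

theorem mult_pos_iff {ρ σ : UnitaryRep G} :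
    0 < mult ρ σ ↔ ∃ X ∈ intertwiners ρ σ, X ≠ 0 := by
  rw [mult, Module.finrank_pos_iff_exists_ne_zero]
  constructor
  · rintro ⟨X, hX⟩
    exact ⟨X, X.2, fun h => hX (Subtype.ext h)⟩
  · rintro ⟨X, hX, h0⟩
    exact ⟨⟨X, hX⟩, fun h => h0 (congrArg Subtype.val h)⟩

/-- Unitary equivalence of unitary representations. -/
def Equivalent (ρ σ : UnitaryRep G) : Prop :=
  ∃ X ∈ intertwiners ρ σ, Xᴴ * X = 1 ∧ X * Xᴴ = 1

namespace Equivalent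

theorem refl (ρ : UnitaryRep G) : Equivalent ρ ρ :=
  ⟨1, one_mem_intertwiners ρ, by simp, by simp⟩

theorem symm {ρ σ : UnitaryRep G} : Equivalent ρ σ → Equivalent σ ρ := by
  rintro ⟨X, hX, h1, h2⟩
  exact ⟨Xᴴ, conjTranspose_mem_intertwiners hX, by simpa using h2, by simpa using h1⟩

theorem trans {ρ σ τ : UnitaryRep G} : Equivalent ρ σ → Equivalent σ τ → Equivalent ρ τ := by
  rintro ⟨X, hX, h1, h2⟩ ⟨Y, hY, h3, h4⟩
  refine ⟨Y * X, mul_mem_intertwiners hY hX, ?_, ?_⟩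
  · rw [conjTranspose_mul, Matrix.mul_assoc, ← Matrix.mul_assoc Yᴴ, h3, Matrix.one_mul, h1]
  · rw [conjTranspose_mul, Matrix.mul_assoc, ← Matrix.mul_assoc X, h2, Matrix.one_mul, h4]

theorem card_eq {ρ σ : UnitaryRep G} : Equivalent ρ σ → Fintype.card ρ.n = Fintype.card σ.n := by
  rintro ⟨X, -, h1, h2⟩
  have := trace_mul_comm Xᴴ X
  rw [h1, h2, trace_one, trace_one] at this
  exact_mod_cast this

theorem mult_right {σ σ' : UnitaryRep G} (h : Equivalent σ σ') (ρ : UnitaryRep G) :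
    mult ρ σ = mult ρ σ' := by
  obtain ⟨X, hX, h1, h2⟩ := h
  refine LinearEquiv.finrank_eq (LinearEquiv.ofLinearMap
    (LinearMap.codRestrict _ ((mulLeftLinearMap ρ.n ℂ X).comp (Submodule.subtype _))
      fun Y => mul_mem_intertwiners hX Y.2)
    (LinearMap.codRestrict _ ((mulLeftLinearMap ρ.n ℂ Xᴴ).comp (Submodule.subtype _))
      fun Y => mul_mem_intertwiners (conjTranspose_mem_intertwiners hX) Y.2) ?_ ?_)
  · ext1 Y
    apply Subtype.ext
    change X * (Xᴴ * Y.1) = Y.1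
    rw [← Matrix.mul_assoc, h2, Matrix.one_mul]
  · ext1 Y
    apply Subtype.ext
    change Xᴴ * (X * Y.1) = Y.1
    rw [← Matrix.mul_assoc, h1, Matrix.one_mul]

theorem mult_left {ρ ρ' : UnitaryRep G} (h : Equivalent ρ ρ') (σ : UnitaryRep G) :
    mult ρ σ = mult ρ' σ := by
  obtain ⟨X, hX, h1, h2⟩ := h
  refine LinearEquiv.finrank_eq (LinearEquiv.ofLinearMap
    (LinearMap.codRestrict _ ((mulRightLinearMap σ.n ℂ Xᴴ).comp (Submodule.subtype _))
      fun Y => mul_mem_intertwiners Y.2 (conjTranspose_mem_intertwiners hX))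
    (LinearMap.codRestrict _ ((mulRightLinearMap σ.n ℂ X).comp (Submodule.subtype _))
      fun Y => mul_mem_intertwiners Y.2 hX) ?_ ?_)
  · ext1 Y
    apply Subtype.ext
    change (Y.1 * X) * Xᴴ = Y.1
    rw [Matrix.mul_assoc, h2, Matrix.mul_one]
  · ext1 Y
    apply Subtype.ext
    change (Y.1 * Xᴴ) * X = Y.1
    rw [Matrix.mul_assoc, h1, Matrix.mul_one]

end Equivalent

/-- Transport of a unitary representation along a unitary matrix. -/
abbrev conj (ρ : UnitaryRep G) {m : Type} [Fintype m] [DecidableEq m] (U : Matrix ρ.n m ℂ)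
    (h1 : Uᴴ * U = 1) (h2 : U * Uᴴ = 1) : UnitaryRep G where
  n := m
  toHom :=
    { toFun := fun g => Uᴴ * ρ.toHom g * U
      map_one' := by simp [h1]
      map_mul' := fun g h => by
        rw [map_mul]
        simp only [Matrix.mul_assoc]
        rw [← Matrix.mul_assoc U, h2, Matrix.one_mul] }
  continuous_toHom := by
    have := ρ.continuous_toHom
    change Continuous fun g => Uᴴ * ρ.toHom g * U
    fun_prop
  conjTranspose_mul_self g := by
    change (Uᴴ * ρ.toHom g * U)ᴴ * (Uᴴ * ρ.toHom g * U) = 1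
    simp only [conjTranspose_mul, conjTranspose_conjTranspose, Matrix.mul_assoc]
    rw [← Matrix.mul_assoc U, h2, Matrix.one_mul, ← Matrix.mul_assoc _ (ρ.toHom g),
      ρ.conjTranspose_mul_self, Matrix.one_mul, h1]

theorem equivalent_conj (ρ : UnitaryRep G) {m : Type} [Fintype m] [DecidableEq m]
    (U : Matrix ρ.n m ℂ) (h1 : Uᴴ * U = 1) (h2 : U * Uᴴ = 1) :
    Equivalent ρ (ρ.conj U h1 h2) := by
  refine ⟨Uᴴ, fun g => ?_, by rwa [conjTranspose_conjTranspose],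
    by rwa [conjTranspose_conjTranspose]⟩
  change Uᴴ * ρ.toHom g * U * Uᴴ = Uᴴ * ρ.toHom g
  rw [Matrix.mul_assoc, h2, Matrix.mul_one]

/-- The direct sum of two unitary representations. -/
abbrev sum (ρ σ : UnitaryRep G) : UnitaryRep G where
  n := ρ.n ⊕ σ.n
  toHom :=
    { toFun := fun g => fromBlocks (ρ.toHom g) 0 0 (σ.toHom g)
      map_one' := by simp
      map_mul' := fun g h => by simp [fromBlocks_multiply] }
  continuous_toHom := ρ.continuous_toHom.matrix_fromBlocks continuous_const continuous_const
    σ.continuous_toHom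
  conjTranspose_mul_self g := by
    change (fromBlocks _ _ _ _)ᴴ * fromBlocks _ _ _ _ = 1
    simp [fromBlocks_conjTranspose, fromBlocks_multiply, conjTranspose_mul_self]

theorem sum_toHom (ρ σ : UnitaryRep G) (g : G) :
    (ρ.sum σ).toHom g = fromBlocks (ρ.toHom g) 0 0 (σ.toHom g) := rfl

theorem mem_intertwiners_sum {τ ρ σ : UnitaryRep G} {X : Matrix (ρ.sum σ).n τ.n ℂ} :
    X ∈ intertwiners τ (ρ.sum σ) ↔
      X.toRows₁ ∈ intertwiners τ ρ ∧ X.toRows₂ ∈ intertwiners τ σ := by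
  simp only [mem_intertwiners, ← forall_and]
  refine forall_congr' fun g => ?_
  have h : (ρ.sum σ).toHom g * X
      = fromRows (ρ.toHom g * X.toRows₁) (σ.toHom g * X.toRows₂) := by
    rw [sum_toHom]
    conv_lhs => rw [← fromRows_toRows X]
    rw [fromBlocks_mul_fromRows]
    simp
  have h' : X * τ.toHom g = fromRows (X.toRows₁ * τ.toHom g) (X.toRows₂ * τ.toHom g) := by
    conv_lhs => rw [← fromRows_toRows X]
    rw [fromRows_mul]
  rw [h, h', fromRows_ext_iff]

theorem mult_sum (τ ρ σ : UnitaryRep G) : mult τ (ρ.sum σ) = mult τ ρ + mult τ σ := by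
  unfold mult
  rw [← Module.finrank_prod]
  refine LinearEquiv.finrank_eq
    { toFun := fun X => (⟨X.1.toRows₁, (mem_intertwiners_sum.1 X.2).1⟩,
        ⟨X.1.toRows₂, (mem_intertwiners_sum.1 X.2).2⟩)
      map_add' := fun _ _ => rfl
      map_smul' := fun _ _ => rfl
      invFun := fun Y => ⟨fromRows Y.1.1 Y.2.1, mem_intertwiners_sum.2 (by simp)⟩
      left_inv := fun X => Subtype.ext (fromRows_toRows X.1)
      right_inv := fun Y => by simp }

theorem Equivalent.sum {ρ ρ' σ σ' : UnitaryRep G} :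
    Equivalent ρ ρ' → Equivalent σ σ' → Equivalent (ρ.sum σ) (ρ'.sum σ') := by
  rintro ⟨X, hX, h1, h2⟩ ⟨Y, hY, h3, h4⟩
  refine ⟨fromBlocks X 0 0 Y, fun g => ?_, ?_, ?_⟩
  · simp [fromBlocks_multiply, hX g, hY g]
  · rw [← fromBlocks_one]
    simp [fromBlocks_conjTranspose, fromBlocks_multiply, h1, h3]
  · rw [← fromBlocks_one]
    simp [fromBlocks_conjTranspose, fromBlocks_multiply, h2, h4]

theorem equivalent_of_reindex {ρ σ : UnitaryRep G} (e : σ.n ≃ ρ.n)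
    (h : ∀ g, σ.toHom g = (ρ.toHom g).submatrix e e) : Equivalent ρ σ := by
  refine ⟨(1 : Matrix ρ.n ρ.n ℂ).submatrix e id, fun g => ?_, ?_, ?_⟩
  · rw [h, submatrix_mul_equiv]
    ext i j
    simp [Matrix.mul_apply, Matrix.one_apply]
  · rw [conjTranspose_submatrix, submatrix_mul_equiv]; simp
  · rw [conjTranspose_submatrix, ← submatrix_mul _ _ _ _ _ Function.bijective_id]; simp

/-- The zero-dimensional representation. -/
abbrev zero (G : Type*) [Group G] [TopologicalSpace G] : UnitaryRep G where
  n := Empty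
  toHom := 1
  continuous_toHom := continuous_const
  conjTranspose_mul_self g := by ext i; exact i.elim

theorem equivalent_sum_zero (ρ : UnitaryRep G) : Equivalent ρ (ρ.sum (zero G)) := by
  refine equivalent_of_reindex (Equiv.sumEmpty ρ.n Empty) fun g => ?_
  ext (i | i) (j | j)
  · rfl
  · exact j.elim
  · exact i.elim
  · exact i.elim

theorem equivalent_sum_assoc (ρ σ τ : UnitaryRep G) :
    Equivalent ((ρ.sum σ).sum τ) (ρ.sum (σ.sum τ)) := by
  refine equivalent_of_reindex (Equiv.sumAssoc ρ.n σ.n τ.n).symm fun g => ?_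
  ext (i | i | i) (j | j | j) <;> rfl

theorem equivalent_sum_comm (ρ σ : UnitaryRep G) : Equivalent (ρ.sum σ) (σ.sum ρ) := by
  refine equivalent_of_reindex (Equiv.sumComm σ.n ρ.n) fun g => ?_
  ext (i | i) (j | j) <;> rfl

/-- The `k`-fold direct sum of a representation. -/
def nsmul (ρ : UnitaryRep G) : ℕ → UnitaryRep G
  | 0 => zero G
  | k + 1 => ρ.sum (nsmul ρ k)

theorem mult_eq_zero_of_isEmpty (τ ρ : UnitaryRep G) [IsEmpty ρ.n] : mult τ ρ = 0 := by
  by_contra h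
  obtain ⟨X, -, hX⟩ := mult_pos_iff.1 (Nat.pos_of_ne_zero h)
  exact hX (Subsingleton.elim _ _)

theorem mult_nsmul (τ ρ : UnitaryRep G) (k : ℕ) : mult τ (ρ.nsmul k) = k * mult τ ρ := by
  induction k with
  | zero =>
    have : IsEmpty (ρ.nsmul 0).n := inferInstanceAs (IsEmpty Empty)
    rw [mult_eq_zero_of_isEmpty, zero_mul]
  | succ k ih =>
    change mult τ (ρ.sum (ρ.nsmul k)) = _
    rw [mult_sum, ih]
    ring

/-- Restriction of a representation along a continuous homomorphism. -/
abbrev comp {H : Type*} [Group H] [TopologicalSpace H] (ρ : UnitaryRep G) (f : H →ₜ* G) :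
    UnitaryRep H where
  n := ρ.n
  toHom := ρ.toHom.comp f.toMonoidHom
  continuous_toHom := ρ.continuous_toHom.comp f.continuous_toFun
  conjTranspose_mul_self x := ρ.conjTranspose_mul_self (f x)

/-- A nonzero representation is irreducible if it has only scalar self-intertwiners. -/
structure Irreducible (ρ : UnitaryRep G) : Prop where
  nonempty : Nonempty ρ.n
  scalar : ∀ X ∈ intertwiners ρ ρ, ∃ c : ℂ, X = c • 1

end UnitaryRep

end UnitaryRepTheory

/-! ### Complete reducibility and Schur's lemma -/

section Decomposition

open Matrix

namespace UnitaryRep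

variable {G : Type*} [Group G] [TopologicalSpace G]

/-- If the self-adjoint self-intertwiners are scalar, then all self-intertwiners are. -/
theorem exists_isHermitian_intertwiner {ρ : UnitaryRep G} {X : Matrix ρ.n ρ.n ℂ}
    (hX : X ∈ intertwiners ρ ρ) (hs : ∀ c : ℂ, X ≠ c • 1) :
    ∃ A ∈ intertwiners ρ ρ, A.IsHermitian ∧ ∀ c : ℂ, A ≠ c • 1 := by
  by_contra! hcon
  obtain ⟨a, ha⟩ := hcon (X + Xᴴ)
    (add_mem hX (conjTranspose_mem_intertwiners hX)) (isHermitian_add_transpose_self X)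
  obtain ⟨b, hb⟩ := hcon (Complex.I • (X - Xᴴ))
    (Submodule.smul_mem _ _ (sub_mem hX (conjTranspose_mem_intertwiners hX))) (by
      rw [IsHermitian, conjTranspose_smul, conjTranspose_sub, conjTranspose_conjTranspose,
        Complex.star_def, Complex.conj_I, neg_smul, ← smul_neg, neg_sub])
  have h1 : Complex.I • Complex.I • (X - Xᴴ) = (Complex.I * b) • (1 : Matrix ρ.n ρ.n ℂ) := by
    rw [hb, smul_smul]
  rw [smul_smul, Complex.I_mul_I, neg_one_smul] at h1
  apply hs ((a - Complex.I * b) / 2)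
  rw [div_eq_inv_mul, mul_smul, sub_smul, ← h1, ← ha]
  ext i j
  simp only [Matrix.smul_apply, Matrix.sub_apply, Matrix.add_apply, Matrix.neg_apply, smul_eq_mul]
  ring

/-- A representation whose off-diagonal blocks vanish is a direct sum. -/
theorem exists_equivalent_sum_of_blocks {ρ : UnitaryRep G} {a b : Type} [Fintype a] [Fintype b]
    [DecidableEq a] [DecidableEq b] (U : Matrix ρ.n (a ⊕ b) ℂ)
    (h1 : Uᴴ * U = 1) (h2 : U * Uᴴ = 1)
    (h12 : ∀ g, (Uᴴ * ρ.toHom g * U).toBlocks₁₂ = 0)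
    (h21 : ∀ g, (Uᴴ * ρ.toHom g * U).toBlocks₂₁ = 0) :
    ∃ σ τ : UnitaryRep G, Equivalent ρ (σ.sum τ) ∧
      Fintype.card σ.n = Fintype.card a ∧ Fintype.card τ.n = Fintype.card b := by
  obtain ⟨M, hM⟩ : ∃ M : G →* Matrix (a ⊕ b) (a ⊕ b) ℂ, M = (ρ.conj U h1 h2).toHom := ⟨_, rfl⟩
  have hcont : Continuous M := hM ▸ (ρ.conj U h1 h2).continuous_toHom
  have hunit : ∀ g, (M g)ᴴ * M g = 1 := hM ▸ (ρ.conj U h1 h2).conjTranspose_mul_self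
  obtain ⟨A, D, hP⟩ : ∃ (A : G → Matrix a a ℂ) (D : G → Matrix b b ℂ),
      ∀ g, M g = fromBlocks (A g) 0 0 (D g) := by
    refine ⟨fun g => (M g).toBlocks₁₁, fun g => (M g).toBlocks₂₂, fun g => ?_⟩
    conv_lhs => rw [← fromBlocks_toBlocks (M g)]
    rw [show (M g).toBlocks₁₂ = 0 from hM ▸ h12 g, show (M g).toBlocks₂₁ = 0 from hM ▸ h21 g]
  have hone := map_one M
  rw [hP, ← fromBlocks_one, fromBlocks_inj] at hone
  have hmul : ∀ g h, M (g * h) = M g * M h := map_mul M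
  simp only [hP, fromBlocks_multiply, fromBlocks_inj, Matrix.mul_zero, Matrix.zero_mul, add_zero,
    zero_add] at hmul
  simp only [hP, ← fromBlocks_one, fromBlocks_conjTranspose, fromBlocks_multiply,
    fromBlocks_inj, Matrix.mul_zero, Matrix.zero_mul, add_zero, zero_add,
    conjTranspose_zero] at hunit
  let σ : UnitaryRep G :=
    { n := a
      toHom :=
        { toFun := A
          map_one' := hone.1
          map_mul' := fun g h => (hmul g h).1 }
      continuous_toHom := continuous_matrix fun i j => by
        simpa [hP] using hcont.matrix_elem (Sum.inl i) (Sum.inl j)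
      conjTranspose_mul_self := fun g => (hunit g).1 }
  let τ : UnitaryRep G :=
    { n := b
      toHom :=
        { toFun := D
          map_one' := hone.2.2.2
          map_mul' := fun g h => (hmul g h).2.2.2 }
      continuous_toHom := continuous_matrix fun i j => by
        simpa [hP] using hcont.matrix_elem (Sum.inr i) (Sum.inr j)
      conjTranspose_mul_self := fun g => (hunit g).2.2.2 }
  refine ⟨σ, τ, (equivalent_conj ρ U h1 h2).trans
    (equivalent_of_reindex (Equiv.refl (a ⊕ b)) fun g => ?_), rfl, rfl⟩
  exact (hP g).symm.trans (by rw [hM]; rfl)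

/-- A nonzero reducible representation is a direct sum of representations of smaller dimension. -/
theorem exists_equivalent_sum {ρ : UnitaryRep G} (hn : Nonempty ρ.n) (hρ : ¬ Irreducible ρ) :
    ∃ σ τ : UnitaryRep G, Equivalent ρ (σ.sum τ) ∧
      Fintype.card σ.n < Fintype.card ρ.n ∧ Fintype.card τ.n < Fintype.card ρ.n := by
  classical
  obtain ⟨X, hX, hs⟩ : ∃ X ∈ intertwiners ρ ρ, ∀ c : ℂ, X ≠ c • 1 := by
    by_contra! h
    exact hρ ⟨hn, h⟩
  obtain ⟨A, hA, hH, hs⟩ := exists_isHermitian_intertwiner hX hs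
  let V : Matrix ρ.n ρ.n ℂ := hH.eigenvectorUnitary
  have hV1 : Vᴴ * V = 1 := Unitary.coe_star_mul_self hH.eigenvectorUnitary
  have hV2 : V * Vᴴ = 1 := mul_eq_one_comm.1 hV1
  let d : ρ.n → ℂ := fun i => hH.eigenvalues i
  have hspec : Vᴴ * A * V = diagonal d := by
    have := hH.spectral_theorem
    rw [Unitary.conjStarAlgAut_apply] at this
    change A = V * diagonal d * Vᴴ at this
    rw [this]
    simp only [Matrix.mul_assoc, hV1, Matrix.mul_one]
    rw [← Matrix.mul_assoc, hV1, Matrix.one_mul]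
  obtain ⟨i₀⟩ := hn
  obtain ⟨i₁, hi₁⟩ : ∃ i₁, d i₁ ≠ d i₀ := by
    by_contra! h
    apply hs (d i₀)
    have h1 : diagonal d = d i₀ • (1 : Matrix ρ.n ρ.n ℂ) := by
      rw [smul_one_eq_diagonal, funext h]
    have h2 : A = V * (Vᴴ * A * V) * Vᴴ := by
      simp only [Matrix.mul_assoc, hV2, Matrix.mul_one]
      rw [← Matrix.mul_assoc, hV2, Matrix.one_mul]
    rw [h2, hspec, h1, Matrix.mul_smul, Matrix.smul_mul, Matrix.mul_one, hV2]
  -- The eigenbasis of A is split into the eigenvalue of i₀ and the rest. Both parts are proper: i₁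
  -- is missing from the first, i₀ from the second.
  let p : ρ.n → Prop := fun i => d i = d i₀
  -- A matrix commuting with `diagonal d` has no entries between different eigenvalues.
  have hzero : ∀ g i j, d i ≠ d j → (Vᴴ * ρ.toHom g * V) i j = 0 := by
    intro g i j hij
    have h1 : diagonal d * (Vᴴ * ρ.toHom g * V) = Vᴴ * ρ.toHom g * V * diagonal d := by
      rw [← hspec]
      calc Vᴴ * A * V * (Vᴴ * ρ.toHom g * V) = Vᴴ * A * (V * Vᴴ) * ρ.toHom g * V := by
            simp only [Matrix.mul_assoc]
        _ = Vᴴ * (ρ.toHom g * A) * V := by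
            rw [hV2, hA g]; simp only [Matrix.mul_assoc, Matrix.mul_one]
        _ = Vᴴ * ρ.toHom g * (V * Vᴴ) * A * V := by
            rw [hV2]; simp only [Matrix.mul_assoc, Matrix.one_mul]
        _ = _ := by simp only [Matrix.mul_assoc]
    have h2 := congrFun (congrFun h1 i) j
    rw [diagonal_mul, mul_diagonal, mul_comm, ← sub_eq_zero, ← mul_sub] at h2
    exact (mul_eq_zero.1 h2).resolve_right (sub_ne_zero.2 hij)
  let e := Equiv.sumCompl p
  have hsub : ∀ g, (V.submatrix id e)ᴴ * ρ.toHom g * V.submatrix id e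
      = (Vᴴ * ρ.toHom g * V).submatrix e e := by
    intro g
    ext i j
    simp [Matrix.mul_apply, Matrix.submatrix_apply]
  obtain ⟨σ, τ, h, h1, h2⟩ := exists_equivalent_sum_of_blocks (ρ := ρ) (V.submatrix id e)
    (by rw [conjTranspose_submatrix, ← submatrix_mul _ _ _ _ _ Function.bijective_id, hV1,
          submatrix_one_equiv])
    (by rw [conjTranspose_submatrix, submatrix_mul_equiv, hV2, submatrix_id_id])
    (fun g => by
      rw [hsub]
      ext i j
      exact hzero g _ _ fun h => j.2 (h.symm.trans i.2))
    (fun g => by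
      rw [hsub]
      ext i j
      exact hzero g _ _ fun h => i.2 (h.trans j.2))
  refine ⟨σ, τ, h, ?_, ?_⟩
  · rw [h1]
    exact Fintype.card_subtype_lt (x := i₁) hi₁
  · rw [h2]
    exact Fintype.card_subtype_lt (x := i₀) (fun h => h rfl)

open scoped ComplexOrder in
/-- Schur's lemma: a nonzero intertwiner between irreducible representations is a multiple of a
unitary one. -/
theorem Irreducible.equivalent_of_ne_zero {ρ σ : UnitaryRep G} (hρ : Irreducible ρ)
    (hσ : Irreducible σ) {X : Matrix σ.n ρ.n ℂ} (hX : X ∈ intertwiners ρ σ) (h0 : X ≠ 0) :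
    Equivalent ρ σ := by
  obtain ⟨c, hc⟩ := hρ.scalar _ (mul_mem_intertwiners (conjTranspose_mem_intertwiners hX) hX)
  obtain ⟨c', hc'⟩ := hσ.scalar _ (mul_mem_intertwiners hX (conjTranspose_mem_intertwiners hX))
  have hcc : c' = c := by
    have h1 : c' • X = c • X := by
      calc c' • X = (c' • (1 : Matrix σ.n σ.n ℂ)) * X := by simp
        _ = X * (c • (1 : Matrix ρ.n ρ.n ℂ)) := by rw [← hc', ← hc, Matrix.mul_assoc]
        _ = c • X := by simp
    rw [← sub_eq_zero, ← sub_smul] at h1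
    exact sub_eq_zero.1 ((smul_eq_zero.1 h1).resolve_right h0)
  obtain ⟨i⟩ := hρ.nonempty
  -- A diagonal entry of Xᴴ X = c is a sum of squared absolute values, so c is real and nonnegative;
  -- dividing X by its square root makes X unitary.
  obtain ⟨r, hr0, hr⟩ : ∃ r : ℝ, 0 ≤ r ∧ c = r := by
    refine ⟨∑ k, ‖X k i‖ ^ 2, Finset.sum_nonneg fun _ _ => by positivity, ?_⟩
    have h1 := congrFun (congrFun hc i) i
    rw [Matrix.mul_apply, Matrix.smul_apply, one_apply_eq, smul_eq_mul, mul_one] at h1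
    rw [← h1]
    push_cast
    refine Finset.sum_congr rfl fun k _ => ?_
    rw [conjTranspose_apply, Complex.star_def, Complex.conj_mul']
  have hr1 : r ≠ 0 := by
    rintro rfl
    rw [hr, Complex.ofReal_zero, zero_smul, conjTranspose_mul_self_eq_zero] at hc
    exact h0 hc
  have hs : ((Real.sqrt r : ℂ))⁻¹ * (Real.sqrt r : ℂ)⁻¹ * r = 1 := by
    rw [← mul_inv, ← Complex.ofReal_mul, Real.mul_self_sqrt hr0, inv_mul_cancel₀]
    exact_mod_cast hr1
  refine ⟨(Real.sqrt r : ℂ)⁻¹ • X, Submodule.smul_mem _ _ hX, ?_, ?_⟩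
  · rw [conjTranspose_smul, Matrix.smul_mul, Matrix.mul_smul, hc, hr, smul_smul, smul_smul]
    simp only [star_inv₀, Complex.star_def, Complex.conj_ofReal]
    rw [hs, one_smul]
  · rw [conjTranspose_smul, Matrix.smul_mul, Matrix.mul_smul, hc', hcc, hr, smul_smul, smul_smul]
    simp only [star_inv₀, Complex.star_def, Complex.conj_ofReal]
    rw [hs, one_smul]

theorem Irreducible.mult_pos_iff_equivalent {ρ σ : UnitaryRep G} (hρ : Irreducible ρ)
    (hσ : Irreducible σ) : 0 < mult ρ σ ↔ Equivalent ρ σ := by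
  constructor
  · intro h
    obtain ⟨X, hX, h0⟩ := mult_pos_iff.1 h
    exact hρ.equivalent_of_ne_zero hσ hX h0
  · rintro h
    have := hρ.nonempty
    rw [← h.mult_right, mult_pos_iff]
    exact ⟨1, one_mem_intertwiners ρ, one_ne_zero⟩

/-- Induction on the dimension: a property of representations that is invariant under equivalence
holds if it holds for the zero and the irreducible representations and for direct sums. -/
theorem induction_irreducible {P : UnitaryRep G → Prop}
    (hequiv : ∀ ρ σ, Equivalent ρ σ → P σ → P ρ) (hempty : ∀ ρ, IsEmpty ρ.n → P ρ)
    (hirr : ∀ ρ, Irreducible ρ → P ρ) (hsum : ∀ ρ σ, P ρ → P σ → P (ρ.sum σ))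
    (ρ : UnitaryRep G) : P ρ := by
  induction hd : Fintype.card ρ.n using Nat.strong_induction_on generalizing ρ with
  | _ d ih =>
    rcases isEmpty_or_nonempty ρ.n with hn | hn
    · exact hempty ρ hn
    · by_cases h : Irreducible ρ
      · exact hirr ρ h
      · obtain ⟨σ, τ, h1, h2, h3⟩ := exists_equivalent_sum hn h
        exact hequiv _ _ h1 (hsum _ _ (ih _ (hd ▸ h2) σ rfl) (ih _ (hd ▸ h3) τ rfl))

/-- An irreducible representation with positive multiplicity splits off as a direct summand. -/
theorem Irreducible.exists_equivalent_sum {τ : UnitaryRep G} (hτ : Irreducible τ)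
    (ρ : UnitaryRep G) (h : 0 < mult τ ρ) : ∃ σ, Equivalent ρ (τ.sum σ) := by
  induction ρ using induction_irreducible with
  | hequiv ρ σ hρσ ih =>
    obtain ⟨σ', h'⟩ := ih (by rwa [← hρσ.mult_right])
    exact ⟨σ', hρσ.trans h'⟩
  | hempty ρ hρ => rw [mult_eq_zero_of_isEmpty] at h; omega
  | hirr ρ hρ =>
    exact ⟨zero G, ((hτ.mult_pos_iff_equivalent hρ).1 h).symm.trans (equivalent_sum_zero τ)⟩
  | hsum ρ σ ihρ ihσ =>
    rw [mult_sum] at h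
    rcases Nat.eq_zero_or_pos (mult τ ρ) with h0 | h0
    · obtain ⟨σ', h'⟩ := ihσ (by omega)
      exact ⟨σ'.sum ρ, (equivalent_sum_comm ρ σ).trans
        ((h'.sum (Equivalent.refl ρ)).trans (equivalent_sum_assoc _ _ _))⟩
    · obtain ⟨ρ', h'⟩ := ihρ h0
      exact ⟨ρ'.sum σ, (h'.sum (Equivalent.refl σ)).trans (equivalent_sum_assoc _ _ _)⟩

theorem exists_irreducible_mult_pos (ρ : UnitaryRep G) (hn : Nonempty ρ.n) :
    ∃ τ : UnitaryRep G, Irreducible τ ∧ 0 < mult τ ρ := by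
  induction ρ using induction_irreducible with
  | hequiv ρ σ hρσ ih =>
    obtain ⟨τ, h1, h2⟩ := ih (by
      rw [← Fintype.card_pos_iff, ← hρσ.card_eq]
      exact Fintype.card_pos)
    exact ⟨τ, h1, by rwa [hρσ.mult_right]⟩
  | hempty ρ hρ => exact (not_isEmpty_iff.2 hn hρ).elim
  | hirr ρ hρ => exact ⟨ρ, hρ, (hρ.mult_pos_iff_equivalent hρ).2 (Equivalent.refl ρ)⟩
  | hsum ρ σ ihρ ihσ =>
    obtain ⟨i | i⟩ := hn
    · obtain ⟨τ, h1, h2⟩ := ihρ ⟨i⟩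
      exact ⟨τ, h1, by rw [mult_sum]; omega⟩
    · obtain ⟨τ, h1, h2⟩ := ihσ ⟨i⟩
      exact ⟨τ, h1, by rw [mult_sum]; omega⟩

/-- Representations with the same multiplicities are unitarily equivalent. -/
theorem equivalent_of_mult_eq (ρ σ : UnitaryRep G)
    (h : ∀ τ, Irreducible τ → mult τ ρ = mult τ σ) : Equivalent ρ σ := by
  induction hd : Fintype.card ρ.n using Nat.strong_induction_on generalizing ρ σ with
  | _ d ih =>
    rcases isEmpty_or_nonempty ρ.n with hn | hn
    · rcases isEmpty_or_nonempty σ.n with hn' | hn'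
      · exact ⟨0, zero_mem _, Subsingleton.elim _ _, Subsingleton.elim _ _⟩
      · obtain ⟨τ, h1, h2⟩ := exists_irreducible_mult_pos σ hn'
        rw [← h τ h1, mult_eq_zero_of_isEmpty] at h2
        omega
    -- A common irreducible constituent is split off from both sides; additivity of multiplicities
    -- lets it cancel, and the dimension drops.
    · obtain ⟨τ, hτ, h1⟩ := exists_irreducible_mult_pos ρ hn
      obtain ⟨ρ', hρ'⟩ := hτ.exists_equivalent_sum ρ h1
      obtain ⟨σ', hσ'⟩ := hτ.exists_equivalent_sum σ (by rwa [← h τ hτ])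
      have hτn := hτ.nonempty
      refine hρ'.trans (((Equivalent.refl τ).sum
        (ih (Fintype.card ρ'.n) ?_ ρ' σ' (fun κ hκ => ?_) rfl)).trans hσ'.symm)
      · have := hρ'.card_eq
        rw [Fintype.card_sum] at this
        have : 0 < Fintype.card τ.n := Fintype.card_pos
        omega
      · have := h κ hκ
        rw [hρ'.mult_right, hσ'.mult_right, mult_sum, mult_sum] at this
        omega

end UnitaryRep

end Decomposition

/-! ### Averaging matrices over Haar measure -/

section Averaging

open Matrix MeasureTheory

variable {G : Type*} [TopologicalSpace G]

theorem mul_integral_mul_apply [CompactSpace G] [MeasurableSpace G] [BorelSpace G]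
    (μ : Measure G) [IsFiniteMeasure μ] {m n p q : Type} [Fintype m] [Fintype n]
    {F : G → Matrix m n ℂ} (hF : Continuous F) (Y : Matrix p m ℂ) (Z : Matrix n q ℂ)
    (i : p) (j : q) :
    (Y * (Matrix.of fun k l => ∫ g, F g k l ∂μ) * Z) i j = ∫ g, (Y * F g * Z) i j ∂μ := by
  have hint : ∀ f : G → ℂ, Continuous f → Integrable f μ := fun f hf =>
    hf.integrable_of_hasCompactSupport (HasCompactSupport.of_compactSpace _)
  have hel : ∀ k l, Continuous fun g => F g k l := fun k l => hF.matrix_elem k l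
  simp only [Matrix.mul_apply, Matrix.of_apply]
  rw [integral_finsetSum _ fun l _ => hint _ (by fun_prop)]
  refine Finset.sum_congr rfl fun l _ => ?_
  rw [integral_mul_const, integral_finsetSum _ fun k _ => hint _ (by fun_prop)]
  congr 1
  refine Finset.sum_congr rfl fun k _ => ?_
  rw [integral_const_mul]

namespace UnitaryRep

variable [Group G]

/-- The average of a matrix over the action of the group. -/
noncomputable def average [MeasurableSpace G] (μ : Measure G) (ρ σ : UnitaryRep G)
    (X : Matrix σ.n ρ.n ℂ) : Matrix σ.n ρ.n ℂ :=
  Matrix.of fun i j => ∫ g, (σ.toHom g * X * (ρ.toHom g)ᴴ) i j ∂μ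

theorem continuous_average_integrand (ρ σ : UnitaryRep G) (X : Matrix σ.n ρ.n ℂ) :
    Continuous fun g => σ.toHom g * X * (ρ.toHom g)ᴴ := by
  have h1 := ρ.continuous_toHom
  have h2 := σ.continuous_toHom
  fun_prop

/-- Left invariance of the measure under g ↦ h g absorbs the conjugation by h into the integral. -/
theorem average_mem_intertwiners [IsTopologicalGroup G] [CompactSpace G] [MeasurableSpace G]
    [BorelSpace G] (μ : Measure G) [IsFiniteMeasure μ] [μ.IsMulLeftInvariant] (ρ σ : UnitaryRep G)
    (X : Matrix σ.n ρ.n ℂ) : average μ ρ σ X ∈ intertwiners ρ σ := by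
  intro h
  have h1 : σ.toHom h * average μ ρ σ X * (ρ.toHom h)ᴴ = average μ ρ σ X := by
    ext i j
    rw [average, mul_integral_mul_apply μ (continuous_average_integrand ρ σ X), Matrix.of_apply,
      ← integral_mul_left_eq_self (fun g => (σ.toHom g * X * (ρ.toHom g)ᴴ) i j) h]
    simp only [map_mul, conjTranspose_mul, Matrix.mul_assoc]
  conv_rhs => rw [← h1]
  rw [Matrix.mul_assoc _ _ (ρ.toHom h), ρ.conjTranspose_mul_self, Matrix.mul_one]

/-- Unitary conjugation preserves the trace and the total mass is 1. Hence an average that is scalar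
can vanish only if the original matrix has trace 0. -/
theorem trace_average [IsTopologicalGroup G] [CompactSpace G] [MeasurableSpace G]
    [BorelSpace G] (μ : Measure G) [IsProbabilityMeasure μ] (ρ : UnitaryRep G)
    (X : Matrix ρ.n ρ.n ℂ) : trace (average μ ρ ρ X) = trace X := by
  have h1 : ∀ g, trace (ρ.toHom g * X * (ρ.toHom g)ᴴ) = trace X := fun g => by
    rw [trace_mul_comm, ← Matrix.mul_assoc, ρ.conjTranspose_mul_self, Matrix.one_mul]
  calc trace (average μ ρ ρ X) = ∫ g, trace (ρ.toHom g * X * (ρ.toHom g)ᴴ) ∂μ := by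
        rw [trace, integral_congr_ae (Filter.Eventually.of_forall fun g => rfl)]
        simp only [trace]
        rw [integral_finsetSum]
        · rfl
        · exact fun i _ => Continuous.integrable_of_hasCompactSupport
            ((continuous_average_integrand ρ ρ X).matrix_elem i i)
            (HasCompactSupport.of_compactSpace _)
    _ = trace X := by simp [h1]

open scoped ComplexOrder in
/-- For an irreducible representation of a compact group, the translates of a nonzero matrix are
not annihilated by a nonzero matrix. -/
theorem Irreducible.exists_mul_mul_ne_zero [IsTopologicalGroup G] [CompactSpace G]
    {ρ : UnitaryRep G} (hρ : Irreducible ρ) {m n : Type} [Fintype m] [Fintype n]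
    {X : Matrix ρ.n n ℂ} (hX : X ≠ 0) {Y : Matrix m ρ.n ℂ} (hY : Y ≠ 0) :
    ∃ g, Y * ρ.toHom g * X ≠ 0 := by
  borelize G
  let μ : Measure G := Measure.haarMeasure ⊤
  have : IsProbabilityMeasure μ := ⟨Measure.haarMeasure_self⟩
  by_contra! hcon
  -- If Y annihilates all translates of X, then it annihilates the scalar average of X Xᴴ, which
  -- forces c = 0; but the trace of X Xᴴ is positive.
  obtain ⟨c, hc⟩ := hρ.scalar _ (average_mem_intertwiners μ ρ ρ (X * Xᴴ))
  have h1 : Y * average μ ρ ρ (X * Xᴴ) * (1 : Matrix ρ.n ρ.n ℂ) = 0 := by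
    ext i j
    rw [average, mul_integral_mul_apply μ (continuous_average_integrand ρ ρ _)]
    have : ∀ g, Y * (ρ.toHom g * (X * Xᴴ) * (ρ.toHom g)ᴴ) * (1 : Matrix ρ.n ρ.n ℂ) = 0 := by
      intro g
      calc _ = (Y * ρ.toHom g * X) * (Xᴴ * (ρ.toHom g)ᴴ) := by
            simp only [Matrix.mul_assoc, Matrix.mul_one]
        _ = 0 := by rw [hcon, Matrix.zero_mul]
    simp [this]
  rw [hc, Matrix.mul_one, Matrix.mul_smul, Matrix.mul_one] at h1
  have hc0 := (smul_eq_zero.1 h1).resolve_right hY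
  have h2 := trace_average μ ρ (X * Xᴴ)
  rw [hc, hc0, zero_smul, trace_zero, eq_comm, trace_mul_conjTranspose_self_eq_zero_iff] at h2
  exact hX h2

end UnitaryRep

end Averaging

/-! ### Matrix coefficients and Stone–Weierstrass -/

section Coefficients

open Matrix

open scoped Kronecker

namespace UnitaryRep

variable {G : Type*} [Group G] [TopologicalSpace G]

/-- The trivial one-dimensional representation. -/
abbrev trivial (G : Type*) [Group G] [TopologicalSpace G] : UnitaryRep G where
  n := Unit
  toHom := 1
  continuous_toHom := continuous_const
  conjTranspose_mul_self g := by simp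

/-- The tensor product of two unitary representations. -/
abbrev tensor (ρ σ : UnitaryRep G) : UnitaryRep G where
  n := ρ.n × σ.n
  toHom :=
    { toFun := fun g => ρ.toHom g ⊗ₖ σ.toHom g
      map_one' := by simp
      map_mul' := fun g h => by rw [map_mul, map_mul, mul_kronecker_mul] }
  continuous_toHom := continuous_matrix fun i j =>
    (ρ.continuous_toHom.matrix_elem i.1 j.1).mul (σ.continuous_toHom.matrix_elem i.2 j.2)
  conjTranspose_mul_self g := by
    change (ρ.toHom g ⊗ₖ σ.toHom g)ᴴ * (ρ.toHom g ⊗ₖ σ.toHom g) = 1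
    rw [conjTranspose_kronecker, ← mul_kronecker_mul, ρ.conjTranspose_mul_self,
      σ.conjTranspose_mul_self, one_kronecker_one]

/-- The complex conjugate of a unitary representation. -/
abbrev complexConj (ρ : UnitaryRep G) : UnitaryRep G where
  n := ρ.n
  toHom :=
    { toFun := fun g => (ρ.toHom g)ᴴᵀ
      map_one' := by simp
      map_mul' := fun g h => by rw [map_mul, conjTranspose_mul, transpose_mul] }
  continuous_toHom := continuous_matrix fun i j =>
    Complex.continuous_conj.comp (ρ.continuous_toHom.matrix_elem i j)
  conjTranspose_mul_self g := by
    change ((ρ.toHom g)ᴴᵀ)ᴴ * (ρ.toHom g)ᴴᵀ = 1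
    rw [show ((ρ.toHom g)ᴴᵀ)ᴴ = (ρ.toHom g)ᵀ by ext i j; simp, ← transpose_mul,
      ρ.conjTranspose_mul_self, transpose_one]

/-- The restrictions to a group `H` of the matrix coefficients of a group `G`. -/
def coefficients {H : Type*} [Group H] [TopologicalSpace H] (φ : H →ₜ* G) :
    StarSubalgebra ℂ C(H, ℂ) where
  carrier := {f | ∃ (ρ : UnitaryRep G) (A : Matrix ρ.n ρ.n ℂ),
    ∀ x, f x = trace (A * ρ.toHom (φ x))}
  mul_mem' := by
    rintro f f' ⟨ρ, A, hA⟩ ⟨σ, B, hB⟩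
    refine ⟨ρ.tensor σ, A ⊗ₖ B, fun x => ?_⟩
    change f x * f' x = trace (A ⊗ₖ B * (ρ.toHom (φ x) ⊗ₖ σ.toHom (φ x)))
    rw [hA, hB, ← mul_kronecker_mul, trace_kronecker]
  add_mem' := by
    rintro f f' ⟨ρ, A, hA⟩ ⟨σ, B, hB⟩
    refine ⟨ρ.sum σ, fromBlocks A 0 0 B, fun x => ?_⟩
    change f x + f' x = trace (fromBlocks A 0 0 B * fromBlocks (ρ.toHom (φ x)) 0 0
      (σ.toHom (φ x)))
    rw [hA, hB, fromBlocks_multiply]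
    simp [trace]
  algebraMap_mem' c := ⟨trivial G, c • 1, fun x => by simp⟩
  star_mem' := by
    rintro f ⟨ρ, A, hA⟩
    refine ⟨ρ.complexConj, Aᴴᵀ, fun x => ?_⟩
    change star (f x) = trace (Aᴴᵀ * (ρ.toHom (φ x))ᴴᵀ)
    rw [hA, ← transpose_mul, ← conjTranspose_mul, trace_transpose, trace_conjTranspose,
      trace_mul_comm]

/-- Stone–Weierstrass: since φ is injective, the representations of G separate the points of H, and
some matrix entry already does so. -/
theorem coefficients_topologicalClosure {G : Type u} [Group G] [TopologicalSpace G]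
    [IsTopologicalGroup G] [CompactSpace G] [T2Space G]
    {H : Type*} [Group H] [TopologicalSpace H] [CompactSpace H] {φ : H →ₜ* G}
    (hφ : Function.Injective φ) : (coefficients φ).topologicalClosure = ⊤ := by
  refine ContinuousMap.starSubalgebra_topologicalClosure_eq_top_of_separatesPoints _ ?_
  intro x y hxy
  obtain ⟨ρ, hρ⟩ := exists_unitaryRep_ne_one (g := (φ x)⁻¹ * φ y) fun h =>
    hxy (hφ (inv_mul_eq_one.1 h))
  have h1 : ρ.toHom (φ x) ≠ ρ.toHom (φ y) := by
    intro h
    apply hρ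
    rw [map_mul, ← h, ← map_mul, inv_mul_cancel, map_one]
  obtain ⟨i, j, hij⟩ : ∃ i j, ρ.toHom (φ x) i j ≠ ρ.toHom (φ y) i j := by
    by_contra! h
    exact h1 (Matrix.ext h)
  have hf : Continuous fun x => ρ.toHom (φ x) i j :=
    (ρ.continuous_toHom.matrix_elem i j).comp φ.continuous_toFun
  refine ⟨fun x => ρ.toHom (φ x) i j, ⟨⟨_, hf⟩, ⟨ρ, Matrix.single j i 1, fun z => ?_⟩, rfl⟩, hij⟩
  simp [Matrix.trace_single_mul]

end UnitaryRep

end Coefficients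

/-! ### Clifford theory and extension of invariant representations -/

section Extension

open Matrix MeasureTheory

namespace UnitaryRep

variable {G : Type u} [Group G] [TopologicalSpace G]
  {H : Type*} [Group H] [TopologicalSpace H]

/-- Every irreducible representation of a compact subgroup occurs in the restriction of a
representation of the group. -/
theorem Irreducible.exists_mult_comp_pos [IsTopologicalGroup H] [CompactSpace H] [IsTopologicalGroup G]
    [CompactSpace G] [T2Space G]
    {φ : H →ₜ* G}
    (hφ : Function.Injective φ) {τ : UnitaryRep H} (hτ : Irreducible τ) :
    ∃ ρ : UnitaryRep G, 0 < mult τ (ρ.comp φ) := by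
  borelize H
  let μ : Measure H := Measure.haarMeasure ⊤
  have : IsProbabilityMeasure μ := ⟨Measure.haarMeasure_self⟩
  by_contra! hcon
  obtain ⟨i⟩ := hτ.nonempty
  -- If τ occurs in no restriction, this coefficient of τ is orthogonal to all restricted
  -- coefficients of G. These are dense, so t is orthogonal to itself, although t 1 = 1.
  let t : C(H, ℂ) := ⟨fun x => τ.toHom x i i, τ.continuous_toHom.matrix_elem i i⟩
  have hint : ∀ f : H → ℂ, Continuous f → Integrable f μ := fun f hf =>
    hf.integrable_of_hasCompactSupport (HasCompactSupport.of_compactSpace _)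
  have hentry : ∀ (ρ : UnitaryRep G) (k l : ρ.n),
      ∫ x, t x * star (ρ.toHom (φ x) k l) ∂μ = 0 := by
    intro ρ k l
    -- The (i, k) entry of this average is the integral in question, and its adjoint would embed τ
    -- nontrivially into the restriction of ρ.
    have h0 : average μ (ρ.comp φ) τ (Matrix.single i l 1) = 0 := by
      by_contra h
      have h1 := conjTranspose_mem_intertwiners
        (average_mem_intertwiners μ (ρ.comp φ) τ (Matrix.single i l 1))
      exact (mult_pos_iff.2 ⟨_, h1, fun h2 => h (conjTranspose_eq_zero.1 h2)⟩).not_ge (hcon ρ)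
    have h1 := congrFun (congrFun h0 i) k
    rw [average, Matrix.of_apply] at h1
    rw [← h1.trans (Matrix.zero_apply i k)]
    refine integral_congr_ae (Filter.Eventually.of_forall fun x => ?_)
    simp [t, Matrix.mul_apply, Matrix.single_apply, ite_and]
  have hcoef : ∀ f ∈ coefficients φ, ∫ x, t x * star (f x) ∂μ = 0 := by
    rintro f ⟨ρ, A, hA⟩
    have h1 : ∀ x, t x * star (f x)
        = ∑ k, ∑ l, star (A k l) * (t x * star (ρ.toHom (φ x) l k)) := by
      intro x
      rw [hA, trace, star_sum, Finset.mul_sum]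
      refine Finset.sum_congr rfl fun k _ => ?_
      rw [Matrix.diag_apply, Matrix.mul_apply, star_sum, Finset.mul_sum]
      refine Finset.sum_congr rfl fun l _ => ?_
      rw [star_mul']
      ring
    have hc : ∀ k l, Continuous fun x => star (A k l) * (t x * star (ρ.toHom (φ x) l k)) := by
      intro k l
      have := (ρ.continuous_toHom.matrix_elem l k).comp φ.continuous_toFun
      exact continuous_const.mul (t.continuous.mul (continuous_star.comp this))
    simp only [h1]
    rw [integral_finsetSum _ fun k _ => hint _ (continuous_finsetSum _ fun l _ => hc k l)]
    refine Finset.sum_eq_zero fun k _ => ?_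
    rw [integral_finsetSum _ fun l _ => hint _ (hc k l)]
    refine Finset.sum_eq_zero fun l _ => ?_
    rw [integral_const_mul, hentry, mul_zero]
  have hnorm : ∫ x, t x * star (t x) ∂μ = 0 := by
    have hmem : t ∈ closure (coefficients φ : Set C(H, ℂ)) := by
      have := coefficients_topologicalClosure hφ
      rw [← StarSubalgebra.topologicalClosure_coe, this]
      trivial
    rw [← norm_eq_zero]
    refine le_antisymm (le_of_forall_pos_le_add fun ε hε => ?_) (norm_nonneg _)
    obtain ⟨f, hf, hd⟩ := Metric.mem_closure_iff.1 hmem (ε / (‖t‖ + 1)) (by positivity)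
    have h1 : ∫ x, t x * star (t x) ∂μ = ∫ x, t x * star ((t - f) x) ∂μ := by
      rw [← sub_zero (∫ x, t x * star (t x) ∂μ), ← hcoef f hf, ← integral_sub]
      · simp only [ContinuousMap.sub_apply, star_sub, mul_sub]
      · exact hint _ (by fun_prop)
      · exact hint _ (by fun_prop)
    rw [h1, zero_add]
    refine (norm_integral_le_of_norm_le_const (C := ε)
      (Filter.Eventually.of_forall fun x => ?_)).trans (by simp)
    rw [norm_mul, norm_star]
    rw [dist_eq_norm] at hd
    calc ‖t x‖ * ‖(t - f) x‖ ≤ (‖t‖ + 1) * (ε / (‖t‖ + 1)) :=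
          mul_le_mul ((t.norm_coe_le_norm x).trans (by linarith))
            (((t - f).norm_coe_le_norm x).trans hd.le) (norm_nonneg _) (by positivity)
      _ = ε := mul_div_cancel₀ _ (by positivity)
  have hreal : ∫ x, ‖t x‖ ^ 2 ∂μ = 0 := by
    have h1 : ∀ x, t x * star (t x) = ((‖t x‖ ^ 2 : ℝ) : ℂ) := fun x => by
      rw [Complex.star_def, Complex.mul_conj']
      norm_cast
    simp only [h1] at hnorm
    rw [integral_complex_ofReal] at hnorm
    exact_mod_cast hnorm
  have hcn : Continuous fun x => ‖t x‖ ^ 2 := t.continuous.norm.pow 2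
  rw [integral_eq_zero_iff_of_nonneg (fun g => by positivity)
    (hcn.integrable_of_hasCompactSupport (HasCompactSupport.of_compactSpace _))] at hreal
  have h1 : (fun x => ‖t x‖ ^ 2) = fun _ => (0 : ℝ) :=
    (Continuous.ae_eq_iff_eq μ hcn continuous_const).1 hreal
  have h2 := congrFun h1 1
  simp [t] at h2

theorem equivalent_sum_comp (ρ σ : UnitaryRep G) (φ : H →ₜ* G) :
    Equivalent ((ρ.sum σ).comp φ) ((ρ.comp φ).sum (σ.comp φ)) :=
  equivalent_of_reindex (Equiv.refl _) fun _ => rfl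

theorem Equivalent.comp {ρ σ : UnitaryRep G} (h : Equivalent ρ σ) (φ : H →ₜ* G) :
    Equivalent (ρ.comp φ) (σ.comp φ) := by
  obtain ⟨X, hX, h1, h2⟩ := h
  exact ⟨X, fun x => hX (φ x), h1, h2⟩

theorem mult_comp_sum (τ : UnitaryRep H) (ρ σ : UnitaryRep G) (φ : H →ₜ* G) :
    mult τ ((ρ.sum σ).comp φ) = mult τ (ρ.comp φ) + mult τ (σ.comp φ) := by
  rw [(equivalent_sum_comp ρ σ φ).mult_right, mult_sum]

theorem mult_comp_nsmul (τ : UnitaryRep H) (ρ : UnitaryRep G) (φ : H →ₜ* G) (k : ℕ) :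
    mult τ ((ρ.nsmul k).comp φ) = k * mult τ (ρ.comp φ) := by
  induction k with
  | zero =>
    have : IsEmpty ((ρ.nsmul 0).comp φ).n := inferInstanceAs (IsEmpty Empty)
    rw [mult_eq_zero_of_isEmpty, zero_mul]
  | succ k ih =>
    change mult τ ((ρ.sum (ρ.nsmul k)).comp φ) = _
    rw [mult_comp_sum, ih]
    ring

/-- Multiplicities in restrictions are additive, so an irreducible summand of any representation
containing τ on H already contains it. -/
theorem Irreducible.exists_irreducible_mult_comp_pos [IsTopologicalGroup H] [CompactSpace H]
    [IsTopologicalGroup G] [CompactSpace G] [T2Space G] {φ : H →ₜ* G}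
    (hφ : Function.Injective φ) {τ : UnitaryRep H} (hτ : Irreducible τ) :
    ∃ ρ : UnitaryRep G, Irreducible ρ ∧ 0 < mult τ (ρ.comp φ) := by
  obtain ⟨ρ, hρ⟩ := hτ.exists_mult_comp_pos hφ
  induction ρ using induction_irreducible with
  | hequiv ρ σ h ih => exact ih (by rwa [← (h.comp φ).mult_right])
  | hempty ρ h =>
    have : IsEmpty (ρ.comp φ).n := h
    rw [mult_eq_zero_of_isEmpty] at hρ
    omega
  | hirr ρ h => exact ⟨ρ, h, hρ⟩
  | hsum ρ σ ihρ ihσ =>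
    rw [mult_comp_sum] at hρ
    rcases Nat.eq_zero_or_pos (mult τ (ρ.comp φ)) with h0 | h0
    · exact ihσ (by omega)
    · exact ihρ h0

/-- Precomposition with a surjective endomorphism does not change intertwiners. -/
theorem mult_comp_comp {ρ σ : UnitaryRep H} {c : H →ₜ* H} (hc : Function.Surjective c) :
    mult (ρ.comp c) (σ.comp c) = mult ρ σ := by
  have : intertwiners (ρ.comp c) (σ.comp c) = intertwiners ρ σ := by
    ext X
    refine ⟨fun h x => ?_, fun h x => h (c x)⟩
    obtain ⟨y, rfl⟩ := hc x
    exact h y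
  unfold mult
  rw [this]

theorem Irreducible.comp {ρ : UnitaryRep H} (hρ : Irreducible ρ) {c : H →ₜ* H}
    (hc : Function.Surjective c) : Irreducible (ρ.comp c) :=
  ⟨hρ.nonempty, fun X hX => hρ.scalar X (hc.forall.2 hX)⟩

/-- The finite list permits an induction that corrects the multiplicities one constituent at a time.
-/
theorem exists_finite_constituents (σ : UnitaryRep H) :
    ∃ L : List (UnitaryRep H), (∀ κ ∈ L, Irreducible κ) ∧
      ∀ τ, Irreducible τ → 0 < mult τ σ → ∃ κ ∈ L, Equivalent τ κ := by
  induction σ using induction_irreducible with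
  | hequiv ρ σ h ih =>
    obtain ⟨L, h1, h2⟩ := ih
    exact ⟨L, h1, fun τ hτ hm => h2 τ hτ (by rwa [← h.mult_right])⟩
  | hempty ρ h =>
    refine ⟨[], by simp, fun τ hτ hm => ?_⟩
    rw [mult_eq_zero_of_isEmpty] at hm
    omega
  | hirr ρ h =>
    exact ⟨[ρ], by simpa using h, fun τ hτ hm =>
      ⟨ρ, by simp, (hτ.mult_pos_iff_equivalent h).1 hm⟩⟩
  | hsum ρ σ ihρ ihσ =>
    obtain ⟨L, h1, h2⟩ := ihρ
    obtain ⟨L', h1', h2'⟩ := ihσ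
    refine ⟨L ++ L', fun κ hκ => ?_, fun τ hτ hm => ?_⟩
    · rcases List.mem_append.1 hκ with h | h
      · exact h1 κ h
      · exact h1' κ h
    · rw [mult_sum] at hm
      rcases Nat.eq_zero_or_pos (mult τ ρ) with h0 | h0
      · obtain ⟨κ, hκ, he⟩ := h2' τ hτ (by omega)
        exact ⟨κ, List.mem_append_right _ hκ, he⟩
      · obtain ⟨κ, hκ, he⟩ := h2 τ hτ h0
        exact ⟨κ, List.mem_append_left _ hκ, he⟩

section Normal

variable {φ : H →ₜ* G} {c : G → (H →ₜ* H)}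

theorem conj_surjective (hφ : Function.Injective φ) (hc : ∀ g x, φ (c g x) = g * φ x * g⁻¹)
    (g : G) : Function.Surjective (c g) := fun x => by
  refine ⟨c g⁻¹ x, hφ ?_⟩
  rw [hc, hc]
  group

/-- Conjugation by g is inner in G, so the matrix of g⁻¹ is an intertwiner. -/
theorem equivalent_comp_comp (hc : ∀ g x, φ (c g x) = g * φ x * g⁻¹) (ρ : UnitaryRep G) (g : G) :
    Equivalent ((ρ.comp φ).comp (c g)) (ρ.comp φ) := by
  refine ⟨ρ.toHom g⁻¹, fun x => ?_, ρ.conjTranspose_mul_self _, ρ.self_mul_conjTranspose _⟩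
  change ρ.toHom (φ x) * ρ.toHom g⁻¹ = ρ.toHom g⁻¹ * ρ.toHom (φ (c g x))
  rw [hc, ← map_mul, ← map_mul]
  group

/-- Clifford's theorem: the irreducible constituents of the restriction of an irreducible
representation to a normal subgroup are conjugate. -/
theorem Irreducible.exists_equivalent_comp [IsTopologicalGroup G] [CompactSpace G]
    (hφ : Function.Injective φ)
    (hc : ∀ g x, φ (c g x) = g * φ x * g⁻¹) {ρ : UnitaryRep G} (hρ : Irreducible ρ)
    {τ κ : UnitaryRep H} (hτ : Irreducible τ) (hκ : Irreducible κ)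
    (h1 : 0 < mult τ (ρ.comp φ)) (h2 : 0 < mult κ (ρ.comp φ)) :
    ∃ g, Equivalent τ (κ.comp (c g)) := by
  obtain ⟨X, hX, hX0⟩ := mult_pos_iff.1 h1
  obtain ⟨Y, hY, hY0⟩ := mult_pos_iff.1 h2
  -- Every Yᴴ ρ(g) X intertwines τ with the g-conjugate of κ; irreducibility of ρ makes one of them
  -- nonzero.
  obtain ⟨g, hg⟩ := hρ.exists_mul_mul_ne_zero hX0 (Y := Yᴴ)
    (fun h => hY0 (conjTranspose_eq_zero.1 h))
  refine ⟨g, hτ.equivalent_of_ne_zero (hκ.comp (conj_surjective hφ hc g)) (fun x => ?_) hg⟩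
  have hX' : ρ.toHom (φ x) * X = X * τ.toHom x := hX x
  have hY' : κ.toHom (c g x) * Yᴴ = Yᴴ * ρ.toHom (φ (c g x)) :=
    conjTranspose_mem_intertwiners hY (c g x)
  change κ.toHom (c g x) * (Yᴴ * ρ.toHom g * X) = Yᴴ * ρ.toHom g * X * τ.toHom x
  calc κ.toHom (c g x) * (Yᴴ * ρ.toHom g * X)
      = (κ.toHom (c g x) * Yᴴ) * ρ.toHom g * X := by simp only [Matrix.mul_assoc]
    _ = Yᴴ * ρ.toHom (φ (c g x) * g) * X := by rw [hY', map_mul, Matrix.mul_assoc Yᴴ]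
    _ = Yᴴ * ρ.toHom g * (ρ.toHom (φ x) * X) := by
        rw [hc, inv_mul_cancel_right, map_mul]; simp only [Matrix.mul_assoc]
    _ = _ := by rw [hX']; simp only [Matrix.mul_assoc]

/-- A representation of a normal subgroup that is invariant under conjugation has a multiple that
extends to the whole group. -/
theorem exists_mult_comp_eq [IsTopologicalGroup H] [CompactSpace H] [IsTopologicalGroup G]
    [CompactSpace G] [T2Space G]
    (hφ : Function.Injective φ)
    (hc : ∀ g x, φ (c g x) = g * φ x * g⁻¹) (σ : UnitaryRep H)
    (hσ : ∀ g, Equivalent (σ.comp (c g)) σ) :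
    ∃ M, 0 < M ∧ ∃ ρ : UnitaryRep G, ∀ τ, Irreducible τ →
      mult τ (ρ.comp φ) = M * mult τ σ := by
  -- The alternative 0 in the invariant means that a conjugacy class of irreducibles is either
  -- already correct or not yet touched.
  have key : ∀ L : List (UnitaryRep H), (∀ κ ∈ L, Irreducible κ) →
      ∃ M, 0 < M ∧ ∃ ρ : UnitaryRep G,
        (∀ τ, Irreducible τ → mult τ (ρ.comp φ) = M * mult τ σ ∨ mult τ (ρ.comp φ) = 0) ∧
        ∀ κ ∈ L, mult κ (ρ.comp φ) = M * mult κ σ := by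
    intro L
    induction L with
    | nil =>
      intro _
      refine ⟨1, one_pos, zero G, fun τ _ => Or.inr ?_, by simp⟩
      have : IsEmpty ((zero G).comp φ).n := inferInstanceAs (IsEmpty Empty)
      exact mult_eq_zero_of_isEmpty _ _
    | cons κ L ih =>
      intro hL
      obtain ⟨M, hM, ρ, h1, h2⟩ := ih fun τ hτ => hL τ (List.mem_cons_of_mem _ hτ)
      have hκ := hL κ List.mem_cons_self
      rcases h1 κ hκ with h0 | h0
      · exact ⟨M, hM, ρ, h1, by simpa [h0] using h2⟩
      obtain ⟨ψ, hψ, hpos⟩ := hκ.exists_irreducible_mult_comp_pos hφ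
      set m := mult κ (ψ.comp φ) with hm
      set n := mult κ σ with hn
      -- By Clifford, the constituents of ψ on H are conjugates of κ. There ρ contributes 0, ψ
      -- contributes m and σ contains n copies, so adding n M copies of ψ to m copies of ρ gives m M
      -- n; elsewhere the old multiplicities are multiplied by m.
      have htot : ∀ τ, mult τ (((ρ.nsmul m).sum (ψ.nsmul (n * M))).comp φ)
          = m * mult τ (ρ.comp φ) + n * M * mult τ (ψ.comp φ) := fun τ => by
        rw [mult_comp_sum, mult_comp_nsmul, mult_comp_nsmul]
      have hconj : ∀ τ, Irreducible τ → 0 < mult τ (ψ.comp φ) →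
          mult τ (((ρ.nsmul m).sum (ψ.nsmul (n * M))).comp φ) = m * M * mult τ σ := by
        intro τ hτ hτψ
        obtain ⟨g, hg⟩ := hψ.exists_equivalent_comp hφ hc hκ hτ hpos hτψ
        have hinv : ∀ ω : UnitaryRep H, Equivalent (ω.comp (c g)) ω → mult κ ω = mult τ ω := by
          intro ω hω
          rw [hg.mult_left, ← hω.mult_right, mult_comp_comp (conj_surjective hφ hc g)]
        rw [htot, ← hinv _ (equivalent_comp_comp hc ρ g), ← hinv _ (equivalent_comp_comp hc ψ g),
          ← hinv _ (hσ g), h0, ← hm, ← hn]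
        ring
      refine ⟨m * M, Nat.mul_pos hpos hM, (ρ.nsmul m).sum (ψ.nsmul (n * M)), ?_, ?_⟩
      · intro τ hτ
        rcases Nat.eq_zero_or_pos (mult τ (ψ.comp φ)) with hz | hz
        · rw [htot, hz, mul_zero, add_zero]
          rcases h1 τ hτ with h | h
          · left; rw [h]; ring
          · right; rw [h, mul_zero]
        · exact Or.inl (hconj τ hτ hz)
      · intro τ hτL
        have hτ := hL τ hτL
        rcases Nat.eq_zero_or_pos (mult τ (ψ.comp φ)) with hz | hz
        · rcases List.mem_cons.1 hτL with rfl | h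
          · exact absurd hz hpos.ne'
          · rw [htot, hz, mul_zero, add_zero, h2 τ h]; ring
        · exact hconj τ hτ hz
  obtain ⟨L, hL, hcons⟩ := exists_finite_constituents σ
  obtain ⟨M, hM, ρ, h1, h2⟩ := key L hL
  refine ⟨M, hM, ρ, fun τ hτ => ?_⟩
  rcases Nat.eq_zero_or_pos (mult τ σ) with hz | hz
  · rcases h1 τ hτ with h | h
    · exact h
    · rw [h, hz, mul_zero]
  · obtain ⟨κ, hκ, he⟩ := hcons τ hτ hz
    rw [he.mult_left, he.mult_left, h2 κ hκ]

end Normal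

end UnitaryRep

end Extension

/-! ### Representations that detect reduced words -/

section Words

open Matrix

/-- Outside a closed normal subgroup, a compact group has unitary representations trivial on the
subgroup with a nonzero off-diagonal entry. -/
theorem exists_unitaryRep_apply_ne_zero {G : Type u} [Group G] [TopologicalSpace G]
    [IsTopologicalGroup G] [CompactSpace G] (N : Subgroup G) [N.Normal]
    (hN : IsClosed (N : Set G)) {g : G} (hg : g ∉ N) :
    ∃ (ρ : UnitaryRep G) (p q : ρ.n), p ≠ q ∧ (∀ x ∈ N, ρ.toHom x = 1) ∧ ρ.toHom g q p ≠ 0 := by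
  have : T3Space (G ⧸ N) := @QuotientGroup.instT3Space G _ _ _ N _ hN
  obtain ⟨U, hU⟩ := exists_unitaryRep_ne_one (G := G ⧸ N) (g := (g : G ⧸ N))
    (fun h => hg ((QuotientGroup.eq_one_iff g).1 h))
  let u : G → Matrix U.n U.n ℂ := fun x => U.toHom (x : G ⧸ N)
  have hu1 : u 1 = 1 := map_one U.toHom
  have hum : ∀ x y, u (x * y) = u x * u y := fun x y => map_mul U.toHom (x : G ⧸ N) y
  have hus : ∀ x, (u x)ᴴ * u x = 1 := fun x => U.conjTranspose_mul_self _
  have huc : Continuous u := U.continuous_toHom.comp continuous_quot_mk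
  have h4 : ∀ (A B C D : Matrix U.n U.n ℂ), A = (2 : ℂ) • C → B = (2 : ℂ) • D →
      (2 : ℂ)⁻¹ • (2 : ℂ)⁻¹ • fromBlocks A B B A = (2 : ℂ)⁻¹ • fromBlocks C D D C := by
    rintro A B C D rfl rfl
    rw [← fromBlocks_smul, smul_smul (2 : ℂ)⁻¹ 2, inv_mul_cancel₀ two_ne_zero, one_smul]
  have h1' : (1 : Matrix (U.n ⊕ U.n) (U.n ⊕ U.n) ℂ)
      = (2 : ℂ)⁻¹ • fromBlocks (1 + 1) (1 - 1) (1 - 1) (1 + 1) := by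
    rw [sub_self, ← two_smul ℂ, ← fromBlocks_one, fromBlocks_smul, smul_smul,
      inv_mul_cancel₀ two_ne_zero, one_smul, smul_zero]
  -- This is 1 ⊕ u rotated by 45 degrees, which moves 1 - u into the off-diagonal blocks.
  let ρ : UnitaryRep G :=
    { n := U.n ⊕ U.n
      toHom :=
        { toFun := fun x => (2 : ℂ)⁻¹ • fromBlocks (1 + u x) (1 - u x) (1 - u x) (1 + u x)
          map_one' := by rw [hu1, ← h1']
          map_mul' := fun x y => by
            rw [Matrix.smul_mul, Matrix.mul_smul, fromBlocks_multiply,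
              add_comm ((1 - u x) * (1 + u y)), add_comm ((1 - u x) * (1 - u y))]
            refine (h4 _ _ _ _ ?_ ?_).symm
            · rw [hum, two_smul]; noncomm_ring
            · rw [hum, two_smul]; noncomm_ring }
      continuous_toHom := by
        refine Continuous.const_smul ?_ (2 : ℂ)⁻¹
        exact (continuous_const.add huc).matrix_fromBlocks (continuous_const.sub huc)
          (continuous_const.sub huc) (continuous_const.add huc)
      conjTranspose_mul_self := fun x => by
        change ((2 : ℂ)⁻¹ • fromBlocks (1 + u x) (1 - u x) (1 - u x) (1 + u x))ᴴ *
          ((2 : ℂ)⁻¹ • fromBlocks (1 + u x) (1 - u x) (1 - u x) (1 + u x)) = 1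
        rw [conjTranspose_smul, Matrix.smul_mul, Matrix.mul_smul, fromBlocks_conjTranspose,
          fromBlocks_multiply, conjTranspose_add, conjTranspose_sub, conjTranspose_one,
          add_comm ((1 - (u x)ᴴ) * (1 + u x)), add_comm ((1 - (u x)ᴴ) * (1 - u x)), h1',
          star_inv₀, star_ofNat]
        refine h4 _ _ _ _ ?_ ?_
        · simp only [add_mul, mul_add, sub_mul, mul_sub, hus, one_mul, mul_one, two_smul]; abel
        · simp only [add_mul, mul_add, sub_mul, mul_sub, hus, one_mul, mul_one, sub_self,
            smul_zero]; abel }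
  have hρ : ∀ x, ρ.toHom x
    = (2 : ℂ)⁻¹ • fromBlocks (1 + u x) (1 - u x) (1 - u x) (1 + u x) := fun _ => rfl
  obtain ⟨s, t, hst⟩ : ∃ s t, (1 - u g) s t ≠ 0 := by
    by_contra! h
    exact hU (sub_eq_zero.1 (Matrix.ext h)).symm
  refine ⟨ρ, Sum.inr t, Sum.inl s, by simp, fun x hx => ?_, ?_⟩
  · have : u x = 1 := by
      change U.toHom (x : G ⧸ N) = 1
      rw [(QuotientGroup.eq_one_iff x).2 hx, map_one]
    rw [hρ, this, ← h1']
  · rw [hρ, Matrix.smul_apply, fromBlocks_apply₁₂]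
    exact smul_ne_zero (by norm_num) hst

/-- The isometry sending the basis vector `p` to a given basis vector and the other basis vectors
to new basis vectors. -/
def gluingMatrix {n m : Type} [DecidableEq n] [DecidableEq m] (b : n) (p : m) :
    Matrix (n ⊕ m) m ℂ :=
  Matrix.of fun x y => if x = (if y = p then Sum.inl b else Sum.inr y) then 1 else 0

section Gluing

variable {n m : Type} [Fintype m] [DecidableEq n] [DecidableEq m] (b : n) (p : m)

theorem conjTranspose_gluingMatrix_mulVec [Fintype n] (w : n ⊕ m → ℂ) (y : m) :
    ((gluingMatrix b p)ᴴ *ᵥ w) y = w (if y = p then Sum.inl b else Sum.inr y) := by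
  by_cases h : y = p <;> simp [gluingMatrix, mulVec, dotProduct, h]

theorem gluingMatrix_mulVec_inr (v : m → ℂ) {q : m} (hq : p ≠ q) :
    (gluingMatrix b p *ᵥ v) (Sum.inr q) = v q := by
  have : ∀ y, (Sum.inr q = if y = p then (Sum.inl b : n ⊕ m) else Sum.inr y) ↔ q = y := by
    intro y
    split_ifs with h
    · simpa [h] using hq.symm
    · simp
  simp [gluingMatrix, mulVec, dotProduct, this]

theorem gluingMatrix_isometry [Fintype n] : (gluingMatrix b p)ᴴ * gluingMatrix b p = 1 := by
  ext y z
  rw [Matrix.mul_apply, Matrix.one_apply]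
  simp only [gluingMatrix, conjTranspose_apply, Matrix.of_apply]
  have : ∀ x, star (if x = (if y = p then (Sum.inl b : n ⊕ m) else Sum.inr y) then (1 : ℂ) else 0)
      = if x = (if y = p then (Sum.inl b : n ⊕ m) else Sum.inr y) then 1 else 0 := by
    intro x; split_ifs <;> simp
  simp only [this, ite_mul, one_mul, zero_mul, Finset.sum_ite_eq',
    Finset.mem_univ, if_true]
  by_cases hy : y = p
  · by_cases hz : z = p
    · simp [hy, hz]
    · simp [hy, hz, Ne.symm hz]
  · by_cases hz : z = p
    · simp [hy, hz]
    · simp [hy, hz]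

/-- The columns of the gluing matrix are the basis vector `Sum.inl b`, fixed because A fixes b, and
basis vectors of the new summand, where the block matrix is the identity. -/
theorem mul_gluingMatrix [Fintype n] {A : Matrix n n ℂ} (hA : A *ᵥ Pi.single b 1 = Pi.single b 1) :
    fromBlocks A 0 0 (1 : Matrix m m ℂ) * gluingMatrix b p = gluingMatrix b p := by
  have hA' : ∀ k, A k b = if k = b then 1 else 0 := fun k => by
    have := congrFun hA k
    simpa [Pi.single_apply] using this
  ext (k | k) y
  · by_cases hy : y = p
    · simp [Matrix.mul_apply, gluingMatrix, hy, hA']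
    · simp [Matrix.mul_apply, gluingMatrix, hy]
  · by_cases hy : y = p
    · simp [Matrix.mul_apply, gluingMatrix, hy]
    · simp [Matrix.mul_apply, gluingMatrix, hy, Matrix.one_apply]

/-- Glue two representations along a vector that is fixed by the first one. -/
theorem exists_glued_representation [Fintype n] {G : Type*} [Group G] [TopologicalSpace G]
    {A : G →* Matrix n n ℂ} {V : G →* Matrix m m ℂ} (hAc : Continuous A) (hVc : Continuous V)
    (hA : ∀ g, (A g)ᴴ * A g = 1) (hV : ∀ g, (V g)ᴴ * V g = 1)
    (hAb : ∀ g, A g *ᵥ Pi.single b 1 = Pi.single b 1) :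
    ∃ B : G →* Matrix (n ⊕ m) (n ⊕ m) ℂ, Continuous B ∧ (∀ g, (B g)ᴴ * B g = 1) ∧
      (∀ g, A g = 1 → V g = 1 → B g = 1) ∧
      (∀ g (v : n → ℂ), v b = 0 → B g *ᵥ Sum.elim v 0 = Sum.elim (A g *ᵥ v) 0) ∧
      ∀ g (v : n → ℂ) (q : m), p ≠ q → (B g *ᵥ Sum.elim v 0) (Sum.inr q) = V g q p * v b := by
  let J := gluingMatrix b p
  have hJ : Jᴴ * J = 1 := gluingMatrix_isometry b p
  let E : G → Matrix (n ⊕ m) (n ⊕ m) ℂ := fun g => fromBlocks (A g) 0 0 1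
  let S : G → Matrix (n ⊕ m) (n ⊕ m) ℂ := fun g => J * V g * Jᴴ
  have hEE : ∀ g, (E g)ᴴ * E g = 1 := fun g => by
    simp [E, fromBlocks_conjTranspose, fromBlocks_multiply, hA]
  have hEJ : ∀ g, E g * J = J := fun g => mul_gluingMatrix b p (hAb g)
  have hJE : ∀ g, Jᴴ * E g = Jᴴ := fun g => by
    have h1 : (E g)ᴴ * J = J := by
      conv_lhs => rw [← hEJ g]
      rw [← Matrix.mul_assoc, hEE, Matrix.one_mul]
    have h2 := congrArg conjTranspose h1
    rwa [conjTranspose_mul, conjTranspose_conjTranspose] at h2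
  have hSS : ∀ g h, S g * S h = S (g * h) := fun g h => by
    calc J * V g * Jᴴ * (J * V h * Jᴴ) = J * V g * (Jᴴ * J) * V h * Jᴴ := by
          simp only [Matrix.mul_assoc]
      _ = J * V (g * h) * Jᴴ := by rw [hJ, map_mul]; simp only [Matrix.mul_assoc, Matrix.one_mul]
  have hES : ∀ g h, E g * S h = S h := fun g h => by
    simp only [S, ← Matrix.mul_assoc, hEJ]
  have hSE : ∀ g h, S h * E g = S h := fun g h => by
    simp only [S, Matrix.mul_assoc, hJE]
  have hE1 : E 1 = 1 := by simp [E]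
  have hEm : ∀ g h, E (g * h) = E g * E h := fun g h => by simp [E, fromBlocks_multiply]
  have hSs : ∀ g, (S g)ᴴ = S g⁻¹ := fun g => by
    have h1 : (V g)ᴴ = V g⁻¹ := by
      rw [← mul_one (V g)ᴴ, ← map_one V, ← mul_inv_cancel g, map_mul, ← mul_assoc, hV, one_mul]
    simp only [S, conjTranspose_mul, conjTranspose_conjTranspose, h1, Matrix.mul_assoc]
  have hEs : ∀ g, (E g)ᴴ = E g⁻¹ := fun g => by
    rw [← mul_one (E g)ᴴ, ← hE1, ← mul_inv_cancel g, hEm, ← mul_assoc, hEE, one_mul]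
  have hmul : ∀ g h, S (g * h) + E (g * h) - S 1 = (S g + E g - S 1) * (S h + E h - S 1) := by
    intro g h
    simp only [mul_add, add_mul, mul_sub, sub_mul, hSS, hES, hSE, one_mul, mul_one, hEm]
    abel
  -- S 1 is the projection onto the image of J. Thus B acts as V on this image, where E is trivial,
  -- and as E on its orthogonal complement.
  let B : G →* Matrix (n ⊕ m) (n ⊕ m) ℂ :=
    { toFun := fun g => S g + E g - S 1
      map_one' := by rw [add_sub_cancel_left, hE1]
      map_mul' := hmul }
  have hB : ∀ g, B g = S g + E g - S 1 := fun _ => rfl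
  have hSv : ∀ g (v : n → ℂ), S g *ᵥ Sum.elim v 0 = J *ᵥ (V g *ᵥ (v b • Pi.single p 1)) := by
    intro g v
    have h1 : Jᴴ *ᵥ Sum.elim v 0 = v b • Pi.single p 1 := by
      ext y
      rw [conjTranspose_gluingMatrix_mulVec]
      by_cases hy : y = p <;> simp [hy]
    simp only [S, ← mulVec_mulVec, h1]
  have hEv : ∀ g (v : n → ℂ), E g *ᵥ Sum.elim v 0 = Sum.elim (A g *ᵥ v) 0 := by
    intro g v
    simp [E, fromBlocks_mulVec]
  refine ⟨B, ?_, fun g => ?_, fun g h1 h2 => ?_, fun g v hv => ?_, fun g v q hq => ?_⟩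
  · have hEc : Continuous E := hAc.matrix_fromBlocks continuous_const continuous_const
      continuous_const
    have hSc : Continuous S := by fun_prop
    exact (hSc.add hEc).sub continuous_const
  · rw [hB, conjTranspose_sub, conjTranspose_add, hSs, hSs, hEs, inv_one, ← hmul,
      inv_mul_cancel, hE1, add_sub_cancel_left]
  · have h3 : S g = S 1 := by simp only [S, h2, map_one]
    have h4 : E g = E 1 := by simp only [E, h1, map_one]
    rw [hB, h3, h4, add_sub_cancel_left, hE1]
  · rw [hB, sub_mulVec, add_mulVec, hSv, hSv, hEv, hv]
    simp
  · rw [hB, sub_mulVec, add_mulVec, hSv, hSv, hEv]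
    simp only [Pi.sub_apply, Pi.add_apply, Sum.elim_inr, Pi.zero_apply, add_zero]
    rw [gluingMatrix_mulVec_inr b p _ hq, gluingMatrix_mulVec_inr b p _ hq]
    simp [mulVec_smul, mul_comm, hq.symm]

end Gluing

/-- The image of a basis vector under a word, given representations of the letters. -/
def wordVec {ι : Type} {G : ι → Type u} [∀ i, Group (G i)] {n : Type} [Fintype n] [DecidableEq n]
    (M : ∀ i, G i →* Matrix n n ℂ) (a : n) (L : List (Σ i, G i)) : n → ℂ :=
  L.foldr (fun l v => M l.1 l.2 *ᵥ v) (Pi.single a 1)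

/-- An alternating word of elements outside closed normal subgroups acts nontrivially in some
family of representations that are trivial on these subgroups. -/
theorem exists_wordVec_ne_zero {ι : Type} {G : ι → Type u} [∀ i, Group (G i)]
    [∀ i, TopologicalSpace (G i)] [∀ i, IsTopologicalGroup (G i)] [∀ i, CompactSpace (G i)]
    (N : ∀ i, Subgroup (G i)) [∀ i, (N i).Normal] (hN : ∀ i, IsClosed (N i : Set (G i)))
    (L : List (Σ i, G i)) (hL : ∀ l ∈ L, l.2 ∉ N l.1)
    (hchain : L.IsChain fun l l' => l.1 ≠ l'.1) :
    ∃ (n : Type) (_ : Fintype n) (_ : DecidableEq n) (M : ∀ i, G i →* Matrix n n ℂ) (a b : n),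
      (∀ i, Continuous (M i)) ∧ (∀ i g, (M i g)ᴴ * M i g = 1) ∧ (∀ i, ∀ g ∈ N i, M i g = 1) ∧
      (∀ i, (∀ l ∈ L.head?, l.1 ≠ i) → ∀ g, M i g *ᵥ Pi.single b 1 = Pi.single b 1) ∧
      wordVec M a L b ≠ 0 ∧ ∀ U, U <:+ L → U ≠ L → wordVec M a U b = 0 := by
  classical
  -- The invariant says that the coordinate b first becomes nonzero when the whole word has been
  -- applied. Moreover all groups other than that of the first letter fix the basis vector b, so the
  -- next letter, which has another index, can be glued on there.
  induction L with
  | nil =>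
    refine ⟨Unit, inferInstance, inferInstance, fun _ => 1, (), (), fun _ => continuous_const,
      by simp, by simp, fun i _ g => by rw [MonoidHom.one_apply, one_mulVec],
      by simp [wordVec], ?_⟩
    intro U hU hne
    exact absurd (List.suffix_nil.1 hU) hne
  | cons l L ih =>
    obtain ⟨i₁, g₁⟩ := l
    obtain ⟨n, _, _, M, a, b, hc, hu, hNM, hfix, hne, hsuf⟩ :=
      ih (fun l hl => hL l (List.mem_cons_of_mem _ hl)) hchain.tail
    obtain ⟨V, p, q, hpq, hVN, hVg⟩ := exists_unitaryRep_apply_ne_zero (N i₁) (hN i₁)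
      (hL ⟨i₁, g₁⟩ List.mem_cons_self)
    have hfix₁ : ∀ g, M i₁ g *ᵥ Pi.single b 1 = Pi.single b 1 :=
      hfix i₁ fun l hl => ((List.isChain_cons.1 hchain).1 l hl).symm
    obtain ⟨B, hBc, hBu, hB1, hBv, hBq⟩ := exists_glued_representation b p (hc i₁)
      V.continuous_toHom (hu i₁) V.conjTranspose_mul_self hfix₁
    let E : ∀ i, G i →* Matrix (n ⊕ V.n) (n ⊕ V.n) ℂ := fun i =>
      { toFun := fun g => fromBlocks (M i g) 0 0 1
        map_one' := by simp
        map_mul' := fun g h => by simp [fromBlocks_multiply] }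
    have hE : ∀ i g, E i g = fromBlocks (M i g) 0 0 1 := fun _ _ => rfl
    -- Only the group of the new letter acts through V; the others act trivially on the added
    -- summand. The new target coordinate is q.
    let M' := Function.update E i₁ B
    have hM₁ : M' i₁ = B := Function.update_self _ _ _
    have hM₂ : ∀ i, i ≠ i₁ → M' i = E i := fun i hi => Function.update_of_ne hi _ _
    -- Proper suffixes of L give vectors with b-coordinate 0, which the gluing does not affect.
    -- Hence the old vectors persist up to and including that of L, all with coordinate 0 at q.
    have hvec : ∀ U, U <:+ L → wordVec M' (Sum.inl a) U = Sum.elim (wordVec M a U) 0 := by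
      intro U
      induction U with
      | nil =>
        intro _
        ext (k | k) <;> simp [wordVec, Pi.single_apply]
      | cons l U ihU =>
        intro hU
        have hU' : U <:+ L := (List.suffix_cons l U).trans hU
        have h0 : wordVec M a U b = 0 := hsuf U hU' fun h => by
          have := hU.length_le
          rw [h, List.length_cons] at this
          omega
        obtain ⟨i, g⟩ := l
        change M' i g *ᵥ wordVec M' (Sum.inl a) U = Sum.elim (M i g *ᵥ wordVec M a U) 0
        rw [ihU hU']
        rcases eq_or_ne i i₁ with rfl | hi
        · rw [hM₁, hBv g _ h0]
        · rw [hM₂ i hi, hE, fromBlocks_mulVec]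
          simp
    refine ⟨n ⊕ V.n, inferInstance, inferInstance, M', Sum.inl a, Sum.inr q, ?_, ?_, ?_, ?_,
      ?_, ?_⟩
    · intro i
      rcases eq_or_ne i i₁ with rfl | hi
      · rwa [hM₁]
      · rw [hM₂ i hi]
        exact (hc i).matrix_fromBlocks continuous_const continuous_const continuous_const
    · intro i g
      rcases eq_or_ne i i₁ with rfl | hi
      · rw [hM₁, hBu]
      · rw [hM₂ i hi, hE]
        simp [fromBlocks_conjTranspose, fromBlocks_multiply, hu]
    · intro i g hg
      rcases eq_or_ne i i₁ with rfl | hi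
      · rw [hM₁, hB1 g (hNM _ g hg) (hVN g hg)]
      · rw [hM₂ i hi, hE, hNM i g hg, fromBlocks_one]
    · intro i hi g
      have hi' : i ≠ i₁ := (hi ⟨i₁, g₁⟩ (by simp)).symm
      rw [hM₂ i hi', hE]
      ext (k | k) <;> simp [Pi.single_apply, Matrix.one_apply]
    · change (M' i₁ g₁ *ᵥ wordVec M' (Sum.inl a) L) (Sum.inr q) ≠ 0
      rw [hvec L List.suffix_rfl, hM₁, hBq g₁ _ q hpq]
      exact mul_ne_zero hVg hne
    · intro U hU hUL
      rw [hvec U ((List.suffix_cons_iff.1 hU).resolve_left hUL)]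
      rfl

end Words

/-! ### From separating representations to algebraic soundness -/

section Separation

open Matrix

instance Matrix.compactSpace_unitaryGroup (n : Type) [Fintype n] [DecidableEq n] :
    CompactSpace (unitaryGroup n ℂ) := by
  suffices h : IsCompact (unitaryGroup n ℂ : Set (Matrix n n ℂ)) from
    isCompact_iff_compactSpace.1 h
  have h1 : IsCompact (Set.pi Set.univ fun _ : n => Set.pi Set.univ fun _ : n =>
      Metric.closedBall (0 : ℂ) 1) :=
    isCompact_univ_pi fun _ => isCompact_univ_pi fun _ => isCompact_closedBall _ _
  refine h1.of_isClosed_subset (isClosed_unitary (R := Matrix n n ℂ)) fun U hU i _ j _ => ?_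
  rw [mem_closedBall_zero_iff]
  exact entry_norm_bound_of_unitary hU i j

open Monoid in
/-- Every element of an amalgamated product is the product of an element of the base group and a
reduced word. -/
theorem exists_base_mul_reduced {ι H : Type*} {G : ι → Type*} [Group H] [∀ i, Group (G i)]
    {φ : ∀ i, H →* G i} (hφ : ∀ i, Function.Injective (φ i))
    (w : PushoutI φ) : ∃ (h : H) (L : CoprodI.Word G), PushoutI.Reduced φ L ∧
      w = PushoutI.base φ h * PushoutI.ofCoprodI L.prod := by
  classical
  obtain ⟨d⟩ := PushoutI.NormalWord.transversal_nonempty φ hφ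
  let v : PushoutI.NormalWord d := PushoutI.NormalWord.equiv w
  refine ⟨v.head, v.toWord, fun l hl hr => v.ne_one l hl ?_,
    (PushoutI.NormalWord.equiv.symm_apply_apply w).symm⟩
  -- A letter in the amalgamated subgroup and in the transversal factors both as l.2 · 1 and as 1 ·
  -- l.2; uniqueness forces it to be 1.
  have h1 := (d.compl l.1).1 (a₁ := (⟨l.2, hr⟩, ⟨1, d.one_mem l.1⟩))
    (a₂ := (⟨1, one_mem _⟩, ⟨l.2, v.normalized l.1 l.2 hl⟩)) (by simp)
  exact (congrArg (fun p => (p.2 : G l.1)) h1).symm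

variable {ι : Type} {H : Type u} [Group H] [TopologicalSpace H]
  {G : ι → Type u} [∀ i, Group (G i)] [∀ i, TopologicalSpace (G i)]

/-- A compatible family of continuous unitary matrix representations. -/
structure CompatibleReps (φ : ∀ i, H →ₜ* G i) where
  n : Type
  [fintype : Fintype n]
  [decEq : DecidableEq n]
  toHom : ∀ i, G i →* Matrix n n ℂ
  base : H →* Matrix n n ℂ
  continuous_toHom : ∀ i, Continuous (toHom i)
  continuous_base : Continuous base
  unitary_toHom : ∀ i g, (toHom i g)ᴴ * toHom i g = 1
  unitary_base : ∀ x, (base x)ᴴ * base x = 1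
  comm : ∀ i, (toHom i).comp (φ i).toMonoidHom = base

attribute [instance] CompatibleReps.fintype CompatibleReps.decEq

/-- The representation of the pushout in groups given by a compatible family. -/
def CompatibleReps.lift {φ : ∀ i, H →ₜ* G i} (R : CompatibleReps φ) :
    AlgPushout φ →* Matrix R.n R.n ℂ :=
  Monoid.PushoutI.lift R.toHom R.base R.comm

theorem CompatibleReps.lift_of {φ : ∀ i, H →ₜ* G i} (R : CompatibleReps φ) (i : ι) (x : G i) :
    R.lift (Monoid.PushoutI.of i x) = R.toHom i x :=
  Monoid.PushoutI.lift_of _ _ _ x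

theorem CompatibleReps.lift_base {φ : ∀ i, H →ₜ* G i} (R : CompatibleReps φ) (x : H) :
    R.lift (Monoid.PushoutI.base _ x) = R.base x :=
  Monoid.PushoutI.lift_base _ _ _ x

/-- A continuous unitary matrix representation as a homomorphism to a compact group. -/
def toULiftUnitaryGroup {K : Type*} [Group K] [TopologicalSpace K] {n : Type} [Fintype n]
    [DecidableEq n] (f : K →* Matrix n n ℂ) (hf : Continuous f) (hu : ∀ g, (f g)ᴴ * f g = 1) :
    K →ₜ* ULift.{u} (unitaryGroup n ℂ) where
  toFun g := ⟨⟨f g, mem_unitaryGroup_iff'.2 (hu g)⟩⟩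
  map_one' := ULift.ext _ _ (Subtype.ext (map_one f))
  map_mul' g h := ULift.ext _ _ (Subtype.ext (map_mul f g h))
  continuous_toFun := continuous_uliftUp.comp (hf.subtype_mk _)

/-- If the compatible families of unitary representations separate the points of the pushout in
groups, then it embeds into the pushout in compact groups. -/
theorem algebraicallySound_of_separating (φ : ∀ i, H →ₜ* G i)
    (hsep : ∀ w : AlgPushout φ, w ≠ 1 → ∃ R : CompatibleReps φ, R.lift w ≠ 1) :
    AlgebraicallySound φ := by
  obtain ⟨P, _, _, j, b, hP⟩ := exists_isCompactPushout φ
  refine ⟨P, _, _, j, b, hP, (injective_iff_map_eq_one _).2 fun w hw => ?_⟩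
  by_contra hne
  obtain ⟨R, hR⟩ := hsep w hne
  -- The unitary group is compact, so R factors through P; the lift only adjusts the universe.
  let k : ∀ i, G i →ₜ* ULift.{u} (unitaryGroup R.n ℂ) := fun i =>
    toULiftUnitaryGroup (R.toHom i) (R.continuous_toHom i) (R.unitary_toHom i)
  let h : H →ₜ* ULift.{u} (unitaryGroup R.n ℂ) :=
    toULiftUnitaryGroup R.base R.continuous_base R.unitary_base
  have hk : ∀ i, (k i).comp (φ i) = h := fun i => by
    ext x : 1
    exact ULift.ext _ _ (Subtype.ext (DFunLike.congr_fun (R.comm i) x))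
  obtain ⟨f, ⟨hf1, hf2⟩, -⟩ := hP.existsUnique_desc _ k h hk
  have hcomp : f.toMonoidHom.comp (algPushoutMap φ j b hP.comm) = algPushoutMap φ k h hk := by
    refine Monoid.PushoutI.hom_ext (fun i => ?_) ?_
    · ext x : 1
      change f (algPushoutMap φ j b hP.comm (Monoid.PushoutI.of i x)) = _
      rw [algPushoutMap_of]
      exact (DFunLike.congr_fun (hf1 i) x).trans (algPushoutMap_of φ k h hk i x).symm
    · ext x : 1
      change f (algPushoutMap φ j b hP.comm (Monoid.PushoutI.base _ x)) = _
      rw [algPushoutMap_base]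
      exact (DFunLike.congr_fun hf2 x).trans (algPushoutMap_base φ k h hk x).symm
  let π : ULift.{u} (unitaryGroup R.n ℂ) →* Matrix R.n R.n ℂ :=
    (unitaryGroup R.n ℂ).subtype.comp MulEquiv.ulift.toMonoidHom
  have hlift : π.comp (algPushoutMap φ k h hk) = R.lift := by
    refine Monoid.PushoutI.hom_ext (fun i => ?_) ?_
    · ext1 x
      change π (algPushoutMap φ k h hk (Monoid.PushoutI.of i x)) = _
      rw [algPushoutMap_of]
      exact (R.lift_of i x).symm
    · ext1 x
      change π (algPushoutMap φ k h hk (Monoid.PushoutI.base _ x)) = _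
      rw [algPushoutMap_base]
      exact (R.lift_base x).symm
  apply hR
  rw [← hlift, ← hcomp]
  change π (f (algPushoutMap φ j b hP.comm w)) = 1
  rw [hw, map_one, map_one]

/-- For normal embeddings of compact groups, the elements outside the amalgamated subgroup are
separated by unitary representations. -/
theorem exists_compatibleReps_of_reduced [∀ i, IsTopologicalGroup (G i)]
    [∀ i, CompactSpace (G i)] [∀ i, T2Space (G i)] [CompactSpace H] (φ : ∀ i, H →ₜ* G i)
    (hφ : ∀ i, IsNormalEmbedding (φ i)) (h : H) (L : Monoid.CoprodI.Word G)
    (hL : Monoid.PushoutI.Reduced (fun i => (φ i).toMonoidHom) L) (hne : L.toList ≠ []) :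
    ∃ R : CompatibleReps φ,
      R.lift (Monoid.PushoutI.base _ h * Monoid.PushoutI.ofCoprodI L.prod) ≠ 1 := by
  have hN : ∀ i, ((φ i).toMonoidHom.range).Normal := fun i => (hφ i).normal
  obtain ⟨n, _, _, M, a, b, hc, hu, hNM, -, hw, hsuf⟩ :=
    exists_wordVec_ne_zero (fun i => (φ i).toMonoidHom.range)
      (fun i => by
        rw [MonoidHom.coe_range]
        exact (isCompact_range (φ i).continuous_toFun).isClosed)
      L.toList hL L.chain_ne
  let R : CompatibleReps φ :=
    { n := n
      toHom := M
      base := 1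
      continuous_toHom := hc
      continuous_base := continuous_const
      unitary_toHom := hu
      unitary_base := by simp
      comm := fun i => MonoidHom.ext fun x => hNM i _ ⟨x, rfl⟩ }
  refine ⟨R, fun h1 => ?_⟩
  have hprod : ∀ U : List (Σ i, G i), R.lift (Monoid.PushoutI.ofCoprodI
      ((U.map fun l => Monoid.CoprodI.of l.2).prod)) *ᵥ Pi.single a 1 = wordVec M a U := by
    intro U
    induction U with
    | nil =>
      rw [List.map_nil, List.prod_nil, map_one, map_one, one_mulVec]
      rfl
    | cons l U ih =>
      rw [List.map_cons, List.prod_cons, map_mul, map_mul, ← mulVec_mulVec, ih,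
        Monoid.PushoutI.ofCoprodI_of, R.lift_of]
      rfl
  have hbase : R.lift (Monoid.PushoutI.base _ h) = 1 := R.lift_base h
  rw [map_mul, hbase, one_mul] at h1
  have h2 := hprod L.toList
  change R.lift (Monoid.PushoutI.ofCoprodI L.prod) *ᵥ Pi.single a 1 = _ at h2
  rw [h1, one_mulVec] at h2
  -- The empty word is a proper suffix, so the starting vector has b-coordinate 0; a word acting as
  -- the identity would make it nonzero.
  have h3 := hsuf [] List.nil_suffix hne.symm
  rw [← h2] at hw
  exact hw h3

theorem UnitaryRep.toHom_eq_one_of_nsmul {σ : UnitaryRep H} {m : ℕ} (hm : 0 < m) {h : H}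
    (hh : (σ.nsmul m).toHom h = 1) : σ.toHom h = 1 := by
  cases m with
  | zero => exact absurd hm (lt_irrefl 0)
  | succ k =>
    have h3 : fromBlocks (σ.toHom h) 0 0 ((σ.nsmul k).toHom h) = 1 := hh
    rw [← fromBlocks_one, fromBlocks_inj] at h3
    exact h3.1

open UnitaryRep in
/-- A conjugation invariant representation of the amalgamated subgroup has a multiple that extends
to all factors. -/
theorem exists_compatibleReps_of_invariant [Finite ι] [∀ i, IsTopologicalGroup (G i)]
    [∀ i, CompactSpace (G i)] [∀ i, T2Space (G i)] [IsTopologicalGroup H] [CompactSpace H]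
    (φ : ∀ i, H →ₜ* G i) (hφ : ∀ i, Function.Injective (φ i))
    (c : ∀ i, G i → (H →ₜ* H)) (hc : ∀ i g x, φ i (c i g x) = g * φ i x * g⁻¹)
    (σ : UnitaryRep H) (hσ : ∀ i g, Equivalent (σ.comp (c i g)) σ) {h : H}
    (hh : σ.toHom h ≠ 1) :
    ∃ R : CompatibleReps φ, R.lift (Monoid.PushoutI.base _ h) ≠ 1 := by
  classical
  have := Fintype.ofFinite ι
  choose M hM ρ hρ using fun i => exists_mult_comp_eq (hφ i) (hc i) σ (hσ i)
  -- Repeating the i-th extension by the product of the other M k gives every restriction the same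
  -- multiplicities as m copies of σ.
  let m := ∏ i, M i
  have hm : 0 < m := Finset.prod_pos fun i _ => hM i
  let ρ' : ∀ i, UnitaryRep (G i) := fun i => (ρ i).nsmul (∏ k ∈ Finset.univ.erase i, M k)
  have hequiv : ∀ i, Equivalent ((ρ' i).comp (φ i)) (σ.nsmul m) := fun i =>
    equivalent_of_mult_eq _ _ fun τ hτ => by
      rw [mult_comp_nsmul, hρ i τ hτ, mult_nsmul, ← mul_assoc,
        Finset.prod_erase_mul _ _ (Finset.mem_univ i)]
  choose X hX hX1 hX2 using hequiv
  -- The restrictions are so far only equivalent; conjugation by X i makes them equal.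
  let R : CompatibleReps φ :=
    { n := (σ.nsmul m).n
      toHom := fun i => ((ρ' i).conj (X i)ᴴ (by rw [conjTranspose_conjTranspose, hX2 i])
        (by rw [conjTranspose_conjTranspose, hX1 i])).toHom
      base := (σ.nsmul m).toHom
      continuous_toHom := fun i => UnitaryRep.continuous_toHom _
      continuous_base := UnitaryRep.continuous_toHom _
      unitary_toHom := fun i => UnitaryRep.conjTranspose_mul_self _
      unitary_base := UnitaryRep.conjTranspose_mul_self _
      comm := fun i => MonoidHom.ext fun x => by
        change (X i)ᴴᴴ * (ρ' i).toHom (φ i x) * (X i)ᴴ = (σ.nsmul m).toHom x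
        have h1 : (σ.nsmul m).toHom x * X i = X i * (ρ' i).toHom (φ i x) := hX i x
        rw [conjTranspose_conjTranspose, ← h1, Matrix.mul_assoc, hX2 i, Matrix.mul_one] }
  refine ⟨R, fun h1 => hh ?_⟩
  have h2 : R.lift (Monoid.PushoutI.base _ h) = (σ.nsmul m).toHom h :=
    R.lift_base h
  exact toHom_eq_one_of_nsmul hm (h2.symm.trans h1)

end Separation

/-! ### The topology of Aut(H) and conjugation on normal subgroups -/

section ConjugationAction

variable {H : Type u} [Group H] [TopologicalSpace H]

theorem continuous_contAutToContinuousMap : Continuous (contAutToContinuousMap H) :=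
  continuous_induced_dom

theorem contAutToContinuousMap_injective : Function.Injective (contAutToContinuousMap H) :=
  fun _ _ h => ContinuousMulEquiv.ext fun x => DFunLike.congr_fun h x

instance contAut_t2Space [T2Space H] : T2Space (H ≃ₜ* H) :=
  T2Space.of_injective_continuous contAutToContinuousMap_injective
    continuous_contAutToContinuousMap

/-- Currying is continuous for the compact-open topology, so joint continuity of an action suffices.
-/
theorem continuous_contAut_of_uncurry {X : Type*} [TopologicalSpace X] (f : X → (H ≃ₜ* H))
    (hf : Continuous fun p : X × H => f p.1 p.2) : Continuous f :=
  continuous_induced_rng.2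
    (ContinuousMap.continuous_of_continuous_uncurry (contAutToContinuousMap H ∘ f) hf)

theorem continuous_contAut_eval [LocallyCompactSpace H] :
    Continuous fun p : (H ≃ₜ* H) × H => p.1 p.2 :=
  (continuous_contAutToContinuousMap.comp continuous_fst).eval continuous_snd

instance contAut_continuousMul [LocallyCompactSpace H] : ContinuousMul (H ≃ₜ* H) where
  continuous_mul := continuous_contAut_of_uncurry _ <|
    continuous_contAut_eval.comp ((continuous_fst.comp continuous_fst).prodMk
      (continuous_contAut_eval.comp
        ((continuous_snd.comp continuous_fst).prodMk continuous_snd)))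

/-- A compact Hausdorff group with continuous multiplication is a topological group. -/
theorem isTopologicalGroup_of_compact {K : Type*} [Group K] [TopologicalSpace K] [CompactSpace K]
    [T2Space K] [ContinuousMul K] : IsTopologicalGroup K where
  continuous_inv := by
    -- This is the graph of inversion. It is closed, hence compact, so its projection to the first
    -- factor is a homeomorphism.
    let S : Set (K × K) := {p | p.1 * p.2 = 1}
    have hS : IsClosed S := isClosed_eq continuous_mul continuous_const
    have : CompactSpace S := isCompact_iff_compactSpace.1 hS.isCompact
    let e : S ≃ K :=
      { toFun := fun p => p.1.1
        invFun := fun x => ⟨(x, x⁻¹), mul_inv_cancel x⟩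
        left_inv := fun p => Subtype.ext (Prod.ext rfl (inv_eq_of_mul_eq_one_right p.2))
        right_inv := fun _ => rfl }
    have he : Continuous e := continuous_fst.comp continuous_subtype_val
    exact (continuous_snd.comp continuous_subtype_val).comp he.continuous_symm_of_equiv_compact_to_t2

variable {G : Type u} [Group G] [TopologicalSpace G] {φ : H →ₜ* G}

namespace IsNormalEmbedding

theorem exists_conj (hφ : IsNormalEmbedding φ) (g : G) (x : H) : ∃ y, φ y = g * φ x * g⁻¹ :=
  hφ.normal.conj_mem _ ⟨x, rfl⟩ g

/-- The element of `H` that corresponds to a conjugate of an element of `H`. -/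
noncomputable def conj (hφ : IsNormalEmbedding φ) (g : G) (x : H) : H := (hφ.exists_conj g x).choose

theorem map_conj (hφ : IsNormalEmbedding φ) (g : G) (x : H) : φ (hφ.conj g x) = g * φ x * g⁻¹ :=
  (hφ.exists_conj g x).choose_spec

theorem continuous_conj [IsTopologicalGroup G] (hφ : IsNormalEmbedding φ) :
    Continuous fun p : G × H => hφ.conj p.1 p.2 := by
  refine hφ.isEmbedding.continuous_iff.2 (Continuous.congr ?_ fun p => (hφ.map_conj p.1 p.2).symm)
  have h : Continuous fun p : G × H => φ p.2 := φ.continuous_toFun.comp continuous_snd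
  exact (continuous_fst.mul h).mul continuous_fst.inv

theorem conj_conj_inv (hφ : IsNormalEmbedding φ) (g : G) (x : H) :
    hφ.conj g (hφ.conj g⁻¹ x) = x :=
  hφ.isEmbedding.injective (by rw [map_conj, map_conj]; group)

/-- The action of a topological group on a normally embedded subgroup by conjugation. -/
noncomputable def conjAut [IsTopologicalGroup G] (hφ : IsNormalEmbedding φ) : G →* (H ≃ₜ* H) where
  toFun g :=
    { toFun := hφ.conj g
      invFun := hφ.conj g⁻¹
      left_inv := fun x => by simpa using hφ.conj_conj_inv g⁻¹ x
      right_inv := hφ.conj_conj_inv g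
      map_mul' := fun x y => hφ.isEmbedding.injective (by
        rw [map_mul, map_conj, map_conj, map_conj, map_mul]; group)
      continuous_toFun := hφ.continuous_conj.comp (.prodMk_right g)
      continuous_invFun := hφ.continuous_conj.comp (.prodMk_right g⁻¹) }
  map_one' := ContinuousMulEquiv.ext fun x => hφ.isEmbedding.injective <| by
    change φ (hφ.conj 1 x) = φ x
    rw [map_conj]; group
  map_mul' g g' := ContinuousMulEquiv.ext fun x => hφ.isEmbedding.injective <| by
    change φ (hφ.conj (g * g') x) = φ (hφ.conj g (hφ.conj g' x))
    rw [map_conj, map_conj, map_conj]; group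

variable [IsTopologicalGroup G]

theorem map_conjAut (hφ : IsNormalEmbedding φ) (g : G) (x : H) :
    φ (hφ.conjAut g x) = g * φ x * g⁻¹ :=
  hφ.map_conj g x

theorem conjAut_eq (hφ : IsNormalEmbedding φ) {g : G} {a : H ≃ₜ* H}
    (h : ∀ x, φ (a x) = g * φ x * g⁻¹) : hφ.conjAut g = a :=
  ContinuousMulEquiv.ext fun x => hφ.isEmbedding.injective ((hφ.map_conjAut g x).trans (h x).symm)

theorem continuous_conjAut (hφ : IsNormalEmbedding φ) : Continuous hφ.conjAut :=
  continuous_contAut_of_uncurry _ hφ.continuous_conj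

theorem isCompact_range_conjAut [CompactSpace G] (hφ : IsNormalEmbedding φ) :
    IsCompact (hφ.conjAut.range : Set (H ≃ₜ* H)) := by
  rw [MonoidHom.coe_range]
  exact isCompact_range hφ.continuous_conjAut

end IsNormalEmbedding

end ConjugationAction

/-! ### Semidirect products with compact groups of automorphisms -/

section SemidirectProduct

open SemidirectProduct

variable {H : Type u} [Group H] [TopologicalSpace H]

/-- The action of a subgroup of the topological automorphism group. -/
def contAutAction (K : Subgroup (H ≃ₜ* H)) : K →* MulAut H where
  toFun a := (a : H ≃ₜ* H).toMulEquiv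
  map_one' := rfl
  map_mul' _ _ := rfl

/-- The semidirect product of a topological group with a group of topological automorphisms. -/
abbrev AutSemidirect (K : Subgroup (H ≃ₜ* H)) : Type u := H ⋊[contAutAction K] K

variable (K : Subgroup (H ≃ₜ* H))

instance autSemidirectTopology : TopologicalSpace (AutSemidirect K) :=
  TopologicalSpace.induced equivProd inferInstance

/-- The semidirect product carries the product topology. -/
def autSemidirectHomeo : AutSemidirect K ≃ₜ H × K :=
  equivProd.toHomeomorphOfIsInducing ⟨rfl⟩

theorem continuous_left : Continuous fun p : AutSemidirect K => p.left :=
  continuous_fst.comp (autSemidirectHomeo K).continuous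

theorem continuous_right : Continuous fun p : AutSemidirect K => p.right :=
  continuous_snd.comp (autSemidirectHomeo K).continuous

theorem continuous_contAutAction [LocallyCompactSpace H] :
    Continuous fun p : K × H => contAutAction K p.1 p.2 :=
  continuous_contAut_eval.comp
    ((continuous_subtype_val.comp continuous_fst).prodMk continuous_snd)

instance autSemidirect_t2Space [T2Space H] : T2Space (AutSemidirect K) :=
  (autSemidirectHomeo K).symm.t2Space

theorem compactSpace_autSemidirect [CompactSpace H] (hK : IsCompact (K : Set (H ≃ₜ* H))) :
    CompactSpace (AutSemidirect K) := by
  have : CompactSpace K := isCompact_iff_compactSpace.1 hK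
  exact (autSemidirectHomeo K).symm.compactSpace

/-- Joint continuity of evaluation makes the multiplication continuous; inversion then follows from
compactness. -/
theorem isTopologicalGroup_autSemidirect [IsTopologicalGroup H] [CompactSpace H] [T2Space H]
    (hK : IsCompact (K : Set (H ≃ₜ* H))) : IsTopologicalGroup (AutSemidirect K) := by
  have := compactSpace_autSemidirect K hK
  have : ContinuousMul K := K.toSubmonoid.continuousMul
  have : ContinuousMul (AutSemidirect K) := by
    refine ⟨(autSemidirectHomeo K).symm.continuous.comp (f := fun p : AutSemidirect K ×
      AutSemidirect K => ((p.1 * p.2).left, (p.1 * p.2).right)) (.prodMk ?_ ?_)⟩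
    · exact ((continuous_left K).comp continuous_fst).mul ((continuous_contAutAction K).comp
        (((continuous_right K).comp continuous_fst).prodMk
          ((continuous_left K).comp continuous_snd)))
    · exact ((continuous_right K).comp continuous_fst).mul
        ((continuous_right K).comp continuous_snd)
  exact isTopologicalGroup_of_compact

/-- The normal factor of the semidirect product. -/
def autSemidirectInl : H →ₜ* AutSemidirect K where
  toMonoidHom := inl
  continuous_toFun := (autSemidirectHomeo K).symm.continuous.comp
    (continuous_id.prodMk continuous_const)

theorem isNormalEmbedding_autSemidirectInl : IsNormalEmbedding (autSemidirectInl K) where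
  isEmbedding := .of_leftInverse (f := fun p : AutSemidirect K => p.left) (fun _ => rfl)
    (continuous_left K) (autSemidirectInl K).continuous_toFun
  normal := by
    change (inl : H →* AutSemidirect K).range.Normal
    rw [range_inl_eq_ker_rightHom]
    infer_instance

theorem autSemidirectInl_apply (a : K) (x : H) :
    autSemidirectInl K ((a : H ≃ₜ* H) x) =
      inr a * autSemidirectInl K x * (inr a)⁻¹ :=
  (inl_aut a x).trans (by rw [map_inv]; rfl)

end SemidirectProduct

/-! ### The normalizer of an embedded compact group -/

section Normalizer

variable {H : Type u} [Group H] [TopologicalSpace H] [CompactSpace H]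

/-- An injective morphism of compact groups is a normal embedding into its normalizer, which is
compact. -/
theorem exists_normalizer {P : Type u} [Group P] [TopologicalSpace P] [IsTopologicalGroup P]
    [CompactSpace P] [T2Space P] (b : H →ₜ* P) (hb : Function.Injective b) :
    ∃ (N : Subgroup P) (_ : CompactSpace N) (b' : H →ₜ* N), IsNormalEmbedding b' ∧
      (∀ x, (b' x : P) = b x) ∧ ∀ g : P, (∀ x, ∃ y, b y = g * b x * g⁻¹) →
        (∀ x, ∃ y, b y = g⁻¹ * b x * g) → g ∈ N := by
  have hcl : IsClosed (Set.range b) := (isCompact_range b.continuous_toFun).isClosed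
  let N : Subgroup P := Subgroup.normalizer (b.toMonoidHom.range : Set P)
  have hmem : ∀ g : P, (∀ x, g * b x * g⁻¹ ∈ Set.range b) →
      (∀ x, g⁻¹ * b x * g ∈ Set.range b) → g ∈ N := fun g h1 h2 => by
    refine Subgroup.mem_normalizer_iff.2 fun p => ⟨?_, fun hp => ?_⟩
    · rintro ⟨x, rfl⟩
      exact h1 x
    · obtain ⟨x, hx⟩ := hp
      have := h2 x
      change b x = _ at hx
      rw [hx] at this
      simpa [mul_assoc] using this
  -- The image of H is compact, hence closed, and normalizing it is an intersection of closed
  -- conditions on g, one pair for each x.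
  have hN : IsClosed (N : Set P) := by
    have : (N : Set P) = ⋂ x, ({g | g * b x * g⁻¹ ∈ Set.range b} ∩
        {g | g⁻¹ * b x * g ∈ Set.range b}) := by
      ext g
      rw [Set.mem_iInter]
      refine ⟨fun hg x => ⟨?_, ?_⟩, fun h => hmem g (fun x => (h x).1) fun x => (h x).2⟩
      · exact (Subgroup.mem_normalizer_iff.1 hg _).1 ⟨x, rfl⟩
      · exact (Subgroup.mem_normalizer_iff''.1 hg _).1 ⟨x, rfl⟩
    rw [this]
    refine isClosed_iInter fun x => (hcl.preimage ?_).inter (hcl.preimage ?_)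
    · exact (continuous_id.mul continuous_const).mul continuous_inv
    · exact (continuous_inv.mul continuous_const).mul continuous_id
  have hbN : ∀ x, b x ∈ N := fun x => Subgroup.le_normalizer ⟨x, rfl⟩
  let b' : H →ₜ* N :=
    { toMonoidHom := b.toMonoidHom.codRestrict N hbN
      continuous_toFun := b.continuous_toFun.subtype_mk _ }
  refine ⟨N, isCompact_iff_compactSpace.1 hN.isCompact, b', ⟨?_, ?_⟩, fun _ => rfl, hmem⟩
  · exact (b'.continuous_toFun.isClosedEmbedding
      fun x y h => hb (congrArg Subtype.val h)).isEmbedding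
  · refine ⟨?_⟩
    rintro _ ⟨x, rfl⟩ g
    obtain ⟨y, hy⟩ := (Subgroup.mem_normalizer_iff.1 g.2 _).1 ⟨x, rfl⟩
    exact ⟨y, Subtype.ext hy⟩

end Normalizer

/-! ### The two implications -/

section Main

variable {H : Type u} [Group H] [TopologicalSpace H] [IsTopologicalGroup H] [CompactSpace H]
  [T2Space H]

/-- A representation of H ⋊ K restricts to a K-invariant one on H, because in H ⋊ K the elements of
K act by conjugation. -/
theorem exists_invariant_unitaryRep_ne_one (K : Subgroup (H ≃ₜ* H))
    (hK : IsCompact (K : Set (H ≃ₜ* H))) {h : H} (hh : h ≠ 1) :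
    ∃ σ : UnitaryRep H, σ.toHom h ≠ 1 ∧
      ∀ a ∈ K, UnitaryRep.Equivalent (σ.comp (a : H →ₜ* H)) σ := by
  have := compactSpace_autSemidirect K hK
  have := isTopologicalGroup_autSemidirect K hK
  have hN := isNormalEmbedding_autSemidirectInl K
  obtain ⟨ρ, hρ⟩ := exists_unitaryRep_ne_one
    (g := autSemidirectInl K h) fun h1 => hh (hN.isEmbedding.injective (h1.trans (map_one _).symm))
  refine ⟨ρ.comp (autSemidirectInl K), hρ, fun a ha => ?_⟩
  have h1 := UnitaryRep.equivalent_comp_comp (φ := autSemidirectInl K)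
    (c := fun g => (hN.conjAut g : H →ₜ* H)) hN.map_conjAut ρ
    (SemidirectProduct.inr ⟨a, ha⟩)
  rwa [hN.conjAut_eq (autSemidirectInl_apply K ⟨a, ha⟩)] at h1

/-- The images of the G i in Aut(H) are compact, so a single K bounds them. Elements of H are
detected by extending K-invariant representations, all others by representations trivial on H. -/
theorem algebraicallySound_of_isFilteredPoset (hH : IsFilteredPoset (CompactAutSubgroup H))
    {ι : Type} [Finite ι] {G : ι → Type u} [∀ i, Group (G i)] [∀ i, TopologicalSpace (G i)]
    [∀ i, IsTopologicalGroup (G i)] [∀ i, CompactSpace (G i)] [∀ i, T2Space (G i)]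
    (φ : ∀ i, H →ₜ* G i) (hφ : ∀ i, IsNormalEmbedding (φ i)) : AlgebraicallySound φ := by
  obtain ⟨⟨K, hK⟩, hle⟩ := hH
    (Set.range fun i => ⟨(hφ i).conjAut.range, (hφ i).isCompact_range_conjAut⟩)
    (Set.finite_range _)
  have hinj : ∀ i, Function.Injective (φ i) := fun i => (hφ i).isEmbedding.injective
  refine algebraicallySound_of_separating φ fun w hw => ?_
  obtain ⟨h, L, hL, rfl⟩ := exists_base_mul_reduced (φ := fun i => (φ i).toMonoidHom) hinj w
  by_cases hne : L.toList = []
  · have hL1 : L.prod = 1 := by rw [Monoid.CoprodI.Word.prod, hne]; rfl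
    rw [hL1, map_one, mul_one] at hw ⊢
    obtain ⟨σ, hσ, hinv⟩ := exists_invariant_unitaryRep_ne_one K hK (h := h) fun h1 =>
      hw (by rw [h1, map_one])
    exact exists_compatibleReps_of_invariant φ hinj (fun i g => ((hφ i).conjAut g : H →ₜ* H))
      (fun i => (hφ i).map_conjAut) σ (fun i g => hinv _ (hle _ ⟨i, rfl⟩ ⟨g, rfl⟩)) hσ
  · exact exists_compatibleReps_of_reduced φ hφ h L hL hne

theorem isFilteredPoset_of_algebraicallySound
    (hH : ∀ (ι : Type) [Finite ι] (G : ι → Type u) [∀ i, Group (G i)]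
      [∀ i, TopologicalSpace (G i)] [∀ i, IsTopologicalGroup (G i)] [∀ i, CompactSpace (G i)]
      [∀ i, T2Space (G i)] (φ : ∀ i, H →ₜ* G i), (∀ i, IsNormalEmbedding (φ i)) →
        AlgebraicallySound φ) :
    IsFilteredPoset (CompactAutSubgroup H) := by
  intro s hs
  obtain ⟨n, K, -, rfl⟩ := hs.fin_param
  have := fun i => compactSpace_autSemidirect (K i).1 (K i).2
  have := fun i => isTopologicalGroup_autSemidirect (K i).1 (K i).2
  have hφ := fun i => isNormalEmbedding_autSemidirectInl (K i).1
  obtain ⟨P, _, _, j, b, hP, hinj⟩ := hH (Fin n) (fun i => AutSemidirect (K i).1)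
    (fun i => autSemidirectInl (K i).1) hφ
  have := hP.isTopologicalGroup
  have := hP.compactSpace
  have := hP.t2Space
  -- H embeds in the amalgamated product, which soundness embeds in P.
  have hb : Function.Injective b := by
    have h1 := hinj.comp (Monoid.PushoutI.base_injective
      (φ := fun i => (autSemidirectInl (K i).1).toMonoidHom) fun i => (hφ i).isEmbedding.injective)
    intro x y hxy
    refine h1 ?_
    change algPushoutMap _ j b hP.comm _ = algPushoutMap _ j b hP.comm _
    rw [algPushoutMap_base, algPushoutMap_base, hxy]
  obtain ⟨N, _, b', hb', hbb, hmem⟩ := exists_normalizer b hb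
  refine ⟨⟨hb'.conjAut.range, hb'.isCompact_range_conjAut⟩, ?_⟩
  rintro _ ⟨i, rfl⟩ a ha
  -- Conjugation by the image of a in P induces a itself on the image of H, so g normalizes that
  -- image.
  let g : P := j i (SemidirectProduct.inr ⟨a, ha⟩)
  have key : ∀ x, b (a x) = g * b x * g⁻¹ := fun x => by
    rw [← hP.comm i]
    change j i (autSemidirectInl (K i).1 (a x)) = g * j i (autSemidirectInl (K i).1 x) * g⁻¹
    rw [autSemidirectInl_apply (K i).1 ⟨a, ha⟩, map_mul, map_mul, map_inv]
  have hg : g ∈ N := hmem g (fun x => ⟨_, key x⟩) fun x => ⟨a.symm x, by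
    have h2 := key (a.symm x)
    rw [a.apply_symm_apply] at h2
    rw [h2]; group⟩
  refine ⟨⟨g, hg⟩, hb'.conjAut_eq fun x => Subtype.ext ?_⟩
  change (b' (a x) : P) = g * b' x * g⁻¹
  rw [hbb, hbb, key]

end Main

theorem mainTheorem5 (H : Type u) [Group H] [TopologicalSpace H] [IsTopologicalGroup H]
    [CompactSpace H] [T2Space H] :
    (∀ (ι : Type) [Finite ι] (G : ι → Type u) [∀ i, Group (G i)] [∀ i, TopologicalSpace (G i)]
        [∀ i, IsTopologicalGroup (G i)] [∀ i, CompactSpace (G i)] [∀ i, T2Space (G i)]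
        (φ : ∀ i, H →ₜ* G i), (∀ i, IsNormalEmbedding (φ i)) → AlgebraicallySound φ) ↔
      IsFilteredPoset (CompactAutSubgroup H) :=
  ⟨isFilteredPoset_of_algebraicallySound, fun hH _ _ _ _ _ _ _ _ φ hφ =>
    algebraicallySound_of_isFilteredPoset hH φ hφ⟩
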